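/- For a real Banach space $Z$, let $L(Z)$ be the space of bounded linear operators on $Z$ with the operator norm, and put $$\Pi(Z)=\{(z,z^*)\in Z\times Z^* : \|z\|=\|z^*\|=z^*(z)=1\}.$$ The numerical radius of $T\in L(Z)$ is $v(T)=\sup\{|z^*(Tz)| : (z,z^*)\in\Pi(Z)\}$, and $T$ attains its numerical radius if this supremum is a maximum. Let $Z$ be either of the real Banach spaces $X=C[0,1]\oplus_1 L_1[0,1]$ (with norm $\|(f,g)\|=\|f\|_\infty+\|g\|_1$) and $Y=C[0,1]\oplus_\infty L_1[0,1]$ (with norm $\|(f,g)\|=\max\{\|f\|_\infty,\|g\|_1\}$). Then for every compact linear operator $T\in L(Z)$ and every $\varepsilon>0$ there is a compact linear operator $S\in L(Z)$ which attains its numerical radius and satisfies $\|T-S\|<\varepsilon$. -/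

import Mathlib

open MeasureTheory
open scoped ENNReal unitInterval

noncomputable section

namespace NumRadius

section General

variable {𝕜 X : Type*} [RCLike 𝕜] [NormedAddCommGroup X] [NormedSpace 𝕜 X]

variable (𝕜 X) in
/-- The set `Π(X)` of pairs `(x, x*)` of norm-one elements of `X` and of its dual with
`x*(x) = 1`. -/
def statePairs : Set (X × StrongDual 𝕜 X) :=
  {p | ‖p.1‖ = 1 ∧ ‖p.2‖ = 1 ∧ p.2 p.1 = 1}

/-- The numerical range `V(T) = {x*(T x) : (x, x*) ∈ Π(X)}` of a bounded linear operator. -/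
def numericalRange (T : X →L[𝕜] X) : Set 𝕜 :=
  (fun p : X × StrongDual 𝕜 X => p.2 (T p.1)) '' statePairs 𝕜 X

/-- The numerical radius `v(T) = sup {|c| : c ∈ V(T)}`. The set is always bounded by `‖T‖`, and it
is nonempty as soon as `X ≠ 0`. -/
def numericalRadius (T : X →L[𝕜] X) : ℝ :=
  sSup ((fun c : 𝕜 => ‖c‖) '' numericalRange T)

variable (𝕜 X) in
/-- The set `NRA(X)` of bounded linear operators which attain their numerical radius: the supremum
defining the numerical radius is a maximum. -/
def NRA : Set (X →L[𝕜] X) :=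
  {T | ∃ c ∈ numericalRange T, ‖c‖ = numericalRadius T}

variable (𝕜 X) in
/-- The set `K(X)` of compact linear operators on `X`. -/
def compactOperators : Set (X →L[𝕜] X) :=
  {T | IsCompactOperator T}

end General

/-- The real Banach space `C[0,1]` with the supremum norm. -/
abbrev C01 : Type := C(I, ℝ)

/-- The real Banach space `L₁[0,1]` with respect to Lebesgue measure. -/
abbrev L101 : Type := Lp ℝ 1 (volume : Measure I)

/-- `C[0,1] ⊕₁ L₁[0,1]`, with norm `‖(f, g)‖ = ‖f‖ + ‖g‖`. -/
abbrev SumOne : Type := WithLp 1 (C01 × L101)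

/-- `C[0,1] ⊕_∞ L₁[0,1]`, with norm `‖(f, g)‖ = max ‖f‖ ‖g‖`. -/
abbrev SumInfty : Type := WithLp ∞ (C01 × L101)

end NumRadius

end

/-!
The idea is to approximate a compact operator by finite rank operators for which both the operator
norm and the numerical radius are attained for structural reasons.

*Attainment.* An operator `S` attains its numerical radius as soon as there are a unit vector `z`
and a sign `θ` with `‖z + θ • S z‖ = 1 + ‖S‖`: a functional norming `z + θ • S z` must be `1` at
`z` and `±‖S‖` at `S z` (`mem_NRA_of_norm_add_eq`). This is applied to the operators
`(f, g) ↦ ∑ i, (∫_{K i} f ∂ν) • u i + ∑ j, (∫_{A j} g) • w j` of `SimpleOperatorData`, where the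
`K i` are disjoint closed sets, the `A j` form a finite measurable partition, and the `L₁`-components of all
`u i` and `w j` are constant on every `A j`. The norm of such an operator is attained at one of
finitely many vectors, built from a continuous `f` with values `±1` on each `K i` or a signed
normalised indicator of some `A j`, or both. Two freedoms remain at the maximiser. The function
`f` is `±1` on the sets `K i` and arbitrary elsewhere, so it can have absolute value `1` where the
`C[0,1]`-component of `S z` has its maximal modulus; and the `L₁`-component of `S z` is constant
on `A j`, hence has one sign there. In either of the two sums this gives `‖z + θ • S z‖ = 1 + ‖S‖`
for a suitable sign `θ` (`SimpleOperatorData.mem_NRA_sumOne`,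
`SimpleOperatorData.mem_NRA_sumInfty`).

*Density.* Let `T` be compact. Composing on the left with Bernstein operators on `C[0,1]` and with
averages over a finite partition on `L₁[0,1]`, which are contractions that converge pointwise to
the identity, replaces `T` by a finite rank operator `∑ m, Ψ m • u m` whose `L₁`-part takes values
in step functions (`exists_finiteRank_norm_sub_le`). It remains to approximate finitely many
functionals in norm. On `C[0,1]`, the Jordan decomposition and the Riesz–Markov–Kakutani theorem
give bounded densities with respect to a common finite measure `ν`; these are uniformly close to
functions constant on the pieces of a finite partition, and each piece is exhausted up to small
measure by a closed set `K i` (`exists_closed_sets_abs_sub_le`). On `L₁[0,1]` the functionals have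
bounded densities, which are again uniformly close to step functions
(`exists_refinement_abs_sub_le`); the partition is taken finer than the one used for the range, as
attainment requires. These approximations are carried out on `C[0,1] × L₁[0,1]` and transported
along the isomorphisms with the two sums (`exists_simpleOperator_conj`).
-/

namespace NumRadius

/-! ### A criterion for attaining the numerical radius -/

section Criterion

variable {Z : Type*} [NormedAddCommGroup Z] [NormedSpace ℝ Z]

/-- A functional norming `z + θ • T z` has to be as large as possible at both `z` and `θ • T z`, so
it forms with `z` a state at which `|φ (T z)| = ‖T‖`, an upper bound of the numerical radius. -/
theorem mem_NRA_of_norm_add_eq {T : Z →L[ℝ] Z} {z : Z} {θ : ℝ} (hz : ‖z‖ = 1)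
    (hθ : |θ| = 1) (h : 1 + ‖T‖ ≤ ‖z + θ • T z‖) : T ∈ NRA ℝ Z := by
  obtain ⟨φ, hφ, hφz⟩ := exists_dual_vector ℝ (z + θ • T z) (by
    intro h0
    rw [h0] at h
    linarith [norm_nonneg T])
  have bound : ∀ (ψ : StrongDual ℝ Z) (x : Z), ‖ψ‖ = 1 → ‖x‖ = 1 → |ψ (T x)| ≤ ‖T‖ := by
    intro ψ x hψ hx
    have h1 := ψ.le_opNorm (T x)
    have h2 := T.le_opNorm x
    rw [hψ, one_mul, Real.norm_eq_abs] at h1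
    rw [hx, mul_one] at h2
    exact h1.trans h2
  have h1 : φ z ≤ 1 := by
    have := φ.le_opNorm z
    rw [hφ, hz, one_mul] at this
    exact (le_abs_self _).trans this
  have h2 : |φ (T z)| ≤ ‖T‖ := bound φ z hφ hz
  have h3 : φ z + θ * φ (T z) = ‖z + θ • T z‖ := by
    simpa using hφz
  have h4 : θ * φ (T z) ≤ |φ (T z)| := by
    refine (le_abs_self _).trans ?_
    rw [abs_mul, hθ, one_mul]
  have hφ1 : φ z = 1 := by linarith
  have hT : |φ (T z)| = ‖T‖ := by linarith
  refine ⟨φ (T z), ⟨(z, φ), ⟨hz, hφ, hφ1⟩, rfl⟩, ?_⟩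
  have hle : ∀ r ∈ (fun c : ℝ => ‖c‖) '' numericalRange T, r ≤ ‖T‖ := by
    rintro _ ⟨_, ⟨⟨x, ψ⟩, ⟨hx, hψ, _⟩, rfl⟩, rfl⟩
    exact bound ψ x hψ hx
  have hmem : ‖T‖ ∈ (fun c : ℝ => ‖c‖) '' numericalRange T :=
    ⟨φ (T z), ⟨(z, φ), ⟨hz, hφ, hφ1⟩, rfl⟩, hT⟩
  rw [Real.norm_eq_abs, hT]
  exact (IsGreatest.csSup_eq ⟨hmem, hle⟩).symm

end Criterion

/-! ### Continuous functions with prescribed signs on closed sets -/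

section Interpolation

variable {ι : Type*} [Finite ι] {K : ι → Set I}

/-- On top of the prescribed signs, the absolute value `1` can be demanded at one further point. -/
theorem exists_continuousMap_eq_sign (hK : ∀ i, IsClosed (K i))
    (hd : Pairwise fun i j => Disjoint (K i) (K j)) (s : ι → ℤˣ) (t : I) :
    ∃ f : C01, ‖f‖ ≤ 1 ∧ (∀ i, ∀ x ∈ K i, f x = (s i : ℤ)) ∧ |f t| = 1 := by
  let P : ℤˣ → Set I := fun u => ⋃ i ∈ {i | s i = u}, K i
  have hP : ∀ s, IsClosed (P s) := fun u =>
    (Set.toFinite _).isClosed_biUnion fun i _ => hK i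
  have hdP : Disjoint (P 1) (P (-1)) := by
    simp only [P, Set.disjoint_iUnion_left, Set.disjoint_iUnion_right]
    intro i hi j hj
    refine hd ?_
    rintro rfl
    simp only [Set.mem_ofPred_eq] at hi hj
    rw [hj] at hi
    exact absurd hi (by decide)
  -- the point `t` is added to one of the two closed sets without destroying disjointness
  obtain ⟨A, B, hA, hB, hAB, hPA, hPB, ht⟩ : ∃ A B : Set I, IsClosed A ∧ IsClosed B ∧
      Disjoint A B ∧ P 1 ⊆ A ∧ P (-1) ⊆ B ∧ (t ∈ A ∨ t ∈ B) := by
    by_cases h : t ∈ P (-1)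
    · exact ⟨P 1, P (-1), hP _, hP _, hdP, subset_rfl, subset_rfl, Or.inr h⟩
    · exact ⟨P 1 ∪ {t}, P (-1), (hP _).union isClosed_singleton, hP _,
        Set.disjoint_union_left.2 ⟨hdP, Set.disjoint_singleton_left.2 h⟩,
        Set.subset_union_left, subset_rfl, Or.inl (Or.inr rfl)⟩
  obtain ⟨h, h0, h1, h01⟩ := exists_continuous_zero_one_of_isClosed hA hB hAB
  refine ⟨1 - (2 : ℝ) • h, ?_, ?_, ?_⟩
  · refine (ContinuousMap.norm_le _ zero_le_one).2 fun x => ?_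
    have := h01 x
    simp only [ContinuousMap.sub_apply, ContinuousMap.one_apply, ContinuousMap.smul_apply,
      smul_eq_mul, Real.norm_eq_abs, abs_le]
    constructor <;> linarith [this.1, this.2]
  · intro i x hx
    have hxP : x ∈ P (s i) := Set.mem_biUnion (show i ∈ {j | s j = s i} from rfl) hx
    rcases Int.units_eq_one_or (s i) with hs | hs
    · rw [hs] at hxP
      simp [hs, h0 (hPA hxP)]
    · rw [hs] at hxP
      simp [hs, h1 (hPB hxP)]
      norm_num
  · rcases ht with ht | ht
    · simp [h0 ht]
    · simp [h1 ht]
      norm_num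

end Interpolation

/-! ### Step functions on a finite partition -/

section Steps

variable {κ : Type*}

/-- The classes of functions which are constant on each fibre of `π`. -/
def stepSubmodule (π : I → κ) : Submodule ℝ L101 where
  carrier := {b | ∃ e : κ → ℝ, b =ᵐ[volume] fun x => e (π x)}
  zero_mem' := ⟨0, Lp.coeFn_zero _ _ _⟩
  add_mem' := by
    rintro a b ⟨e, he⟩ ⟨e', he'⟩
    refine ⟨e + e', ?_⟩
    filter_upwards [Lp.coeFn_add a b, he, he'] with x h1 h2 h3
    rw [h1, Pi.add_apply, h2, h3, Pi.add_apply]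
  smul_mem' := by
    rintro c a ⟨e, he⟩
    refine ⟨c • e, ?_⟩
    filter_upwards [Lp.coeFn_smul c a, he] with x h1 h2
    rw [h1, Pi.smul_apply, h2, Pi.smul_apply]

/-- The indicator function of `A`, normalised in `L₁`; it is `0` if `A` is a null set. -/
noncomputable def normalizedIndicator {A : Set I} (hA : MeasurableSet A) : L101 :=
  indicatorConstLp 1 hA (measure_ne_top volume A) (volume.real A)⁻¹

theorem norm_normalizedIndicator {A : Set I} (hA : MeasurableSet A) (h0 : volume A ≠ 0) :
    ‖normalizedIndicator hA‖ = 1 := by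
  have : volume.real A ≠ 0 := by simpa [Measure.real, ENNReal.toReal_eq_zero_iff] using h0
  rw [normalizedIndicator, norm_indicatorConstLp one_ne_zero ENNReal.one_ne_top]
  simp [abs_of_nonneg, this]

theorem setIntegral_normalizedIndicator {A B : Set I} (hA : MeasurableSet A)
    (hB : MeasurableSet B) :
    ∫ x in B, normalizedIndicator hA x = volume.real (A ∩ B) * (volume.real A)⁻¹ := by
  rw [normalizedIndicator, setIntegral_indicatorConstLp hB, smul_eq_mul]

theorem normalizedIndicator_mem_stepSubmodule {π : I → κ} {j : κ}
    (hj : MeasurableSet (π ⁻¹' {j})) :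
    normalizedIndicator hj ∈ stepSubmodule π := by
  classical
  refine ⟨fun i => if i = j then (volume.real (π ⁻¹' {j}))⁻¹ else 0, ?_⟩
  filter_upwards [indicatorConstLp_coeFn (p := 1) (hs := hj)
    (hμs := measure_ne_top volume (π ⁻¹' {j})) (c := (volume.real (π ⁻¹' {j}))⁻¹)] with x hx
  rw [normalizedIndicator, hx]
  simp [Set.indicator_apply]

/-- A function in `L₁` that is constant on `A` has, up to a sign, the same direction on `A` as the
indicator function of `A`, so the norm is additive. -/
theorem exists_norm_normalizedIndicator_add_eq {π : I → κ} {j : κ} (hj : MeasurableSet (π ⁻¹' {j}))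
    (h0 : volume (π ⁻¹' {j}) ≠ 0) {b : L101} (hb : b ∈ stepSubmodule π) :
    ∃ θ : ℝ, |θ| = 1 ∧ ‖normalizedIndicator hj + θ • b‖ = 1 + ‖b‖ := by
  obtain ⟨e, he⟩ := hb
  refine ⟨if 0 ≤ e j then 1 else -1, by split_ifs <;> simp, ?_⟩
  set θ : ℝ := if 0 ≤ e j then 1 else -1 with hθ
  rw [← norm_normalizedIndicator hj h0, L1.norm_eq_integral_norm, L1.norm_eq_integral_norm,
    L1.norm_eq_integral_norm,
    ← integral_add (L1.integrable_coeFn _).norm (L1.integrable_coeFn _).norm]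
  refine integral_congr_ae ?_
  filter_upwards [Lp.coeFn_add (normalizedIndicator hj) (θ • b), Lp.coeFn_smul θ b, he,
    indicatorConstLp_coeFn (p := 1) (hs := hj)
    (hμs := measure_ne_top volume (π ⁻¹' {j})) (c := (volume.real (π ⁻¹' {j}))⁻¹)]
    with x h1 h2 h3 h4
  have h4' : normalizedIndicator hj x = _ := h4
  have hc : 0 ≤ (volume.real (π ⁻¹' {j}))⁻¹ := inv_nonneg.2 measureReal_nonneg
  rw [h1, Pi.add_apply, h2, Pi.smul_apply, h3, h4', smul_eq_mul]
  simp only [Real.norm_eq_abs]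
  by_cases hx : π x = j
  · rw [Set.indicator_of_mem (show x ∈ π ⁻¹' {j} from hx), hx, abs_of_nonneg hc]
    by_cases h : 0 ≤ e j
    · rw [hθ, if_pos h, one_mul, abs_of_nonneg h, abs_of_nonneg (add_nonneg hc h)]
    · rw [hθ, if_neg h, abs_of_neg (not_le.1 h), neg_one_mul, abs_of_nonneg]
      linarith
  · rw [Set.indicator_of_notMem (show x ∉ π ⁻¹' {j} from hx), zero_add, abs_zero, zero_add, abs_mul]
    have : |θ| = 1 := by rw [hθ]; split_ifs <;> simp
    rw [this, one_mul]

theorem sum_measureReal_preimage_singleton [Fintype κ] {μ : Measure I} [IsFiniteMeasure μ]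
    {π : I → κ} (hπ : ∀ j, MeasurableSet (π ⁻¹' {j})) :
    ∑ j, μ.real (π ⁻¹' {j}) = μ.real Set.univ := by
  rw [← measureReal_iUnion_fintype]
  · congr 1
    ext x
    simp
  · intro i j hij
    exact Disjoint.preimage _ (Set.disjoint_singleton.2 hij)
  · exact hπ

theorem sum_setIntegral_preimage_singleton [Fintype κ] {μ : Measure I}
    {π : I → κ} (hπ : ∀ j, MeasurableSet (π ⁻¹' {j})) {g : I → ℝ} (hg : Integrable g μ) :
    ∑ j, ∫ x in π ⁻¹' {j}, g x ∂μ = ∫ x, g x ∂μ := by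
  have hU : ⋃ j, π ⁻¹' {j} = Set.univ := Set.eq_univ_of_forall fun x => by simp
  rw [← integral_iUnion_fintype hπ
    (fun i j hij => Disjoint.preimage _ (Set.disjoint_singleton.2 hij)) fun i => hg.integrableOn,
    hU, Measure.restrict_univ]

theorem sum_abs_setIntegral_le_norm [Fintype κ] {π : I → κ} (hπ : ∀ j, MeasurableSet (π ⁻¹' {j}))
    (g : L101) : ∑ j, |∫ x in π ⁻¹' {j}, g x| ≤ ‖g‖ := by
  rw [L1.norm_eq_integral_norm,
    ← sum_setIntegral_preimage_singleton hπ (L1.integrable_coeFn g).norm]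
  exact Finset.sum_le_sum fun j _ => abs_integral_le_integral_abs

theorem exists_volume_preimage_singleton_ne_zero [Fintype κ] {π : I → κ}
    (hπ : ∀ j, MeasurableSet (π ⁻¹' {j})) : ∃ j, volume (π ⁻¹' {j}) ≠ 0 := by
  by_contra! h
  have := sum_measureReal_preimage_singleton (μ := volume) hπ
  simp [Measure.real, h] at this

end Steps

/-! ### Maximising functionals given by integrals -/

section Domination

variable {ι κ : Type*} [Fintype ι] [Fintype κ]

/-- A combination of integrals over sets `K i` is maximal on the unit ball of `C[0,1]` at functions
which on each `K i` have the sign of the coefficient. -/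
theorem exists_sign_sum_setIntegral_le {ν : Measure I} [IsFiniteMeasure ν] (K : ι → Set I)
    (α : ι → ℝ) :
    ∃ s : ι → ℤˣ, ∀ f : C01, ∑ i, (∫ x in K i, f x ∂ν) * α i ≤
      ‖f‖ * ∑ i, (s i : ℤ) * ν.real (K i) * α i := by
  refine ⟨fun i => if 0 ≤ α i then 1 else -1, fun f => ?_⟩
  rw [Finset.mul_sum]
  refine Finset.sum_le_sum fun i _ => ?_
  have h1 : |∫ x in K i, f x ∂ν| ≤ ‖f‖ * ν.real (K i) :=
    norm_setIntegral_le_of_norm_le_const (measure_lt_top ν _) fun x _ => f.norm_coe_le_norm x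
  have h2 : (∫ x in K i, f x ∂ν) * α i ≤ ‖f‖ * ν.real (K i) * |α i| := by
    refine (le_abs_self _).trans ?_
    rw [abs_mul]
    exact mul_le_mul_of_nonneg_right h1 (abs_nonneg _)
  refine h2.trans_eq ?_
  by_cases h : 0 ≤ α i
  · simp [h, abs_of_nonneg h]
    ring
  · simp [h, abs_of_neg (not_le.1 h)]
    ring

/-- A combination of integrals over the fibres of `π` is maximal on the unit ball of `L₁[0,1]` at
the normalised indicator of a fibre of positive measure with the largest coefficient. -/
theorem exists_sum_setIntegral_le {π : I → κ} (hπ : ∀ j, MeasurableSet (π ⁻¹' {j})) (β : κ → ℝ) :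
    ∃ (j : {j // volume (π ⁻¹' {j}) ≠ 0}) (τ : ℤˣ), ∀ g : L101,
      ∑ j, (∫ x in π ⁻¹' {j}, g x) * β j ≤ ‖g‖ * ((τ : ℤ) * β j) := by
  classical
  obtain ⟨j₀, hj₀⟩ := exists_volume_preimage_singleton_ne_zero hπ
  obtain ⟨j, hj, hmax⟩ := (Finset.univ.filter fun j => volume (π ⁻¹' {j}) ≠ 0).exists_max_image
    (fun j => |β j|) ⟨j₀, by simpa using hj₀⟩
  refine ⟨⟨j, by simpa using hj⟩, if 0 ≤ β j then 1 else -1, fun g => ?_⟩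
  have hτ : (((if 0 ≤ β j then 1 else -1 : ℤˣ) : ℤ) : ℝ) * β j = |β j| := by
    by_cases h : 0 ≤ β j
    · simp [h, abs_of_nonneg h]
    · simp [h, abs_of_neg (not_le.1 h)]
  simp only [hτ]
  calc ∑ i, (∫ x in π ⁻¹' {i}, g x) * β i
      ≤ ∑ i, |∫ x in π ⁻¹' {i}, g x| * |β j| := by
        refine Finset.sum_le_sum fun i _ => ?_
        by_cases hi : volume (π ⁻¹' {i}) = 0
        · rw [setIntegral_measure_zero _ hi]
          simp
        · refine (le_abs_self _).trans ?_
          rw [abs_mul]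
          exact mul_le_mul_of_nonneg_left (hmax i (by simpa using hi)) (abs_nonneg _)
    _ = (∑ i, |∫ x in π ⁻¹' {i}, g x|) * |β j| := by rw [Finset.sum_mul]
    _ ≤ ‖g‖ * |β j| := mul_le_mul_of_nonneg_right (sum_abs_setIntegral_le_norm hπ g) (abs_nonneg _)

end Domination

/-! ### Simple operators -/

/-- The data of a finite rank operator on `C[0,1] × L₁[0,1]` of the form
`(f, g) ↦ ∑ i, (∫_{K i} f ∂ν) • u i + ∑ j, (∫_{π = j} g) • w j`,
where the `K i` are disjoint closed sets, `ν` is a finite measure, and the `L₁`-components of the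
vectors `u i` and `w j` are constant on the fibres of the same partition `π`. -/
structure SimpleOperatorData (ι κ : Type*) [Fintype ι] [Fintype κ] where
  /-- the measure on the `C[0,1]` side -/
  ν : Measure I
  /-- the measure is finite -/
  finite : IsFiniteMeasure ν
  /-- the disjoint closed sets -/
  K : ι → Set I
  isClosed : ∀ i, IsClosed (K i)
  disjoint : Pairwise fun i j => Disjoint (K i) (K j)
  /-- the index map of the partition -/
  π : I → κ
  measurable : ∀ j, MeasurableSet (π ⁻¹' {j})
  /-- the coefficients of the integrals over `K i` -/
  u : ι → C01 × L101
  /-- the coefficients of the integrals over the fibres of `π` -/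
  w : κ → C01 × L101
  u_mem : ∀ i, (u i).2 ∈ stepSubmodule π
  w_mem : ∀ j, (w j).2 ∈ stepSubmodule π

namespace SimpleOperatorData

variable {ι κ : Type*} [Fintype ι] [Fintype κ] (D : SimpleOperatorData ι κ)

attribute [instance] SimpleOperatorData.finite

/-- The operator given by the data, as a function. -/
noncomputable def toFun (z : C01 × L101) : C01 × L101 :=
  ∑ i, (∫ x in D.K i, z.1 x ∂D.ν) • D.u i + ∑ j, (∫ x in D.π ⁻¹' {j}, z.2 x) • D.w j

theorem snd_toFun_mem (z : C01 × L101) : (D.toFun z).2 ∈ stepSubmodule D.π := by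
  rw [toFun, Prod.snd_add, Prod.snd_sum, Prod.snd_sum]
  exact add_mem (sum_mem fun i _ => Submodule.smul_mem _ _ (D.u_mem i))
    (sum_mem fun j _ => Submodule.smul_mem _ _ (D.w_mem j))

/-- The operator sees `f` only on the sets `K i`; so `f` can be altered elsewhere. -/
theorem toFun_congr_fst {f f' : C01} (h : ∀ i, ∀ x ∈ D.K i, f x = f' x) (g : L101) :
    D.toFun (f, g) = D.toFun (f', g) := by
  unfold toFun
  congr 1
  refine Finset.sum_congr rfl fun i _ => ?_
  rw [setIntegral_congr_fun (D.isClosed i).measurableSet fun x hx => h i x hx]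

/-- For a fixed functional `ℓ`, the supremum of `ℓ ∘ S` over the unit ball of `C[0,1]` is attained
at every `f'` with suitable signs on the sets `K i`. -/
theorem exists_sign_le (ℓ : C01 × L101 →ₗ[ℝ] ℝ) :
    ∃ s : ι → ℤˣ, ∀ f' : C01, (∀ i, ∀ x ∈ D.K i, f' x = (s i : ℤ)) →
      ∀ f, ℓ (D.toFun (f, 0)) ≤ ‖f‖ * ℓ (D.toFun (f', 0)) := by
  obtain ⟨s, hs⟩ := exists_sign_sum_setIntegral_le (ν := D.ν) D.K fun i => ℓ (D.u i)
  have key : ∀ f : C01, ℓ (D.toFun (f, 0)) = ∑ i, (∫ x in D.K i, f x ∂D.ν) * ℓ (D.u i) := by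
    intro f
    simp [toFun]
  refine ⟨s, fun f' hf' f => ?_⟩
  rw [key, key]
  refine (hs f).trans_eq ?_
  congr 1
  refine Finset.sum_congr rfl fun i _ => ?_
  rw [setIntegral_congr_fun (D.isClosed i).measurableSet fun x hx => hf' i x hx]
  simp [mul_comm]

/-- For a fixed functional `ℓ`, the supremum of `ℓ ∘ S` over the unit ball of `L₁[0,1]` is attained
at a signed normalised indicator. -/
theorem exists_normalizedIndicator_le (ℓ : C01 × L101 →ₗ[ℝ] ℝ) :
    ∃ (j : {j // volume (D.π ⁻¹' {j}) ≠ 0}) (τ : ℤˣ), ∀ g : L101, ℓ (D.toFun (0, g)) ≤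
      ‖g‖ * ℓ (D.toFun (0, ((τ : ℤ) : ℝ) • normalizedIndicator (D.measurable j))) := by
  classical
  obtain ⟨j, τ, h⟩ := exists_sum_setIntegral_le D.measurable fun j => ℓ (D.w j)
  have key : ∀ g : L101, ℓ (D.toFun (0, g)) = ∑ j, (∫ x in D.π ⁻¹' {j}, g x) * ℓ (D.w j) := by
    intro g
    simp [toFun]
  refine ⟨j, τ, fun g => ?_⟩
  rw [key, key]
  refine (h g).trans_eq ?_
  congr 1
  have hj0 : volume.real (D.π ⁻¹' {j.1}) ≠ 0 := by
    simpa [Measure.real, ENNReal.toReal_eq_zero_iff] using j.2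
  have hint : ∀ i, ∫ x in D.π ⁻¹' {i},
      (((τ : ℤ) : ℝ) • normalizedIndicator (D.measurable j)) x = if i = j then (τ : ℤ) else 0 := by
    intro i
    rw [integral_congr_ae (ae_restrict_of_ae (Lp.coeFn_smul ((τ : ℤ) : ℝ) _))]
    simp only [Pi.smul_apply]
    rw [integral_smul, setIntegral_normalizedIndicator _ (D.measurable i)]
    by_cases hij : i = j
    · subst hij
      simp [hj0]
    · have : D.π ⁻¹' {j.1} ∩ D.π ⁻¹' {i} = ∅ :=
        (Disjoint.preimage _ (Set.disjoint_singleton.2 (Ne.symm hij))).inter_eq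
      simp [this, hij]
  simp [hint]

end SimpleOperatorData

/-! ### Simple operators attain their numerical radius -/

theorem abs_intUnit_cast (τ : ℤˣ) : |((τ : ℤ) : ℝ)| = 1 := by
  rcases Int.units_eq_one_or τ with h | h <;> simp [h]

theorem exists_abs_apply_eq_norm (a : C01) : ∃ t, |a t| = ‖a‖ := by
  obtain ⟨t, -, ht⟩ := isCompact_univ.exists_isMaxOn Set.univ_nonempty
    (a.continuous.abs.continuousOn)
  exact ⟨t, le_antisymm (a.norm_coe_le_norm t) ((ContinuousMap.norm_le _ (abs_nonneg _)).2
    fun x => ht (Set.mem_univ x))⟩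

/-- If `|f|` and `|a|` are maximal at the same point, a sign aligns the two values there. -/
theorem exists_norm_add_smul_ge {f a : C01} {t : I} (hf : |f t| = 1) (ha : |a t| = ‖a‖) :
    ∃ θ : ℝ, |θ| = 1 ∧ 1 + ‖a‖ ≤ ‖f + θ • a‖ := by
  refine ⟨if 0 ≤ f t * a t then 1 else -1, by split_ifs <;> simp, ?_⟩
  have h1 : 1 + ‖a‖ = |f t| + |a t| := by rw [hf, ha]
  refine le_trans ?_ (ContinuousMap.norm_coe_le_norm _ t)
  rw [h1, ContinuousMap.add_apply, ContinuousMap.smul_apply, smul_eq_mul, Real.norm_eq_abs]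
  split_ifs with h
  · rw [one_mul]
    refine ((abs_add_eq_add_abs_iff _ _).2 ?_).ge
    rcases mul_nonneg_iff.1 h with h | h
    · exact Or.inl h
    · exact Or.inr h
  · rw [← abs_neg (a t), neg_one_mul]
    refine ((abs_add_eq_add_abs_iff _ _).2 ?_).ge
    rcases mul_neg_iff.1 (not_le.1 h) with h | h
    · exact Or.inl ⟨h.1.le, by linarith [h.2]⟩
    · exact Or.inr ⟨h.1.le, by linarith [h.2]⟩

namespace SimpleOperatorData

variable {ι κ : Type*} [Fintype ι] [Fintype κ] (D : SimpleOperatorData ι κ)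

theorem mem_NRA_sumOne {S : SumOne →L[ℝ] SumOne}
    (hS : ∀ z : C01 × L101, S (WithLp.toLp 1 z) = WithLp.toLp 1 (D.toFun z)) :
    S ∈ NRA ℝ SumOne := by
  classical
  choose F hF1 hFs hFt using fun s => exists_continuousMap_eq_sign D.isClosed D.disjoint s
  have hne := exists_volume_preimage_singleton_ne_zero D.measurable
  -- the finitely many candidates among which the norm is attained; the point `0` is arbitrary
  let c : (ι → ℤˣ) ⊕ {j // volume (D.π ⁻¹' {j}) ≠ 0} → C01 × L101 :=
    Sum.elim (fun s => (F s 0, 0)) (fun j => (0, normalizedIndicator (D.measurable j)))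
  obtain ⟨m, hm⟩ := Finite.exists_max fun m => ‖S (WithLp.toLp 1 (c m))‖
  have hbound : ‖S‖ ≤ ‖S (WithLp.toLp 1 (c m))‖ := by
    refine S.opNorm_le_bound (norm_nonneg _) fun z => ?_
    obtain ⟨φ, hφ, hφz⟩ := exists_dual_vector'' ℝ (S z)
    let ℓ : C01 × L101 →ₗ[ℝ] ℝ :=
      φ.toLinearMap ∘ₗ (WithLp.linearEquiv 1 ℝ (C01 × L101)).symm.toLinearMap
    have hℓ : ∀ w, ℓ (D.toFun w) = φ (S (WithLp.toLp 1 w)) := fun w => by rw [hS]; rfl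
    have hle : ∀ w, φ w ≤ ‖w‖ := fun w =>
      (le_abs_self _).trans ((φ.le_opNorm w).trans (mul_le_of_le_one_left (norm_nonneg _) hφ))
    obtain ⟨s, hs⟩ := D.exists_sign_le ℓ
    obtain ⟨j, τ, hj⟩ := D.exists_normalizedIndicator_le ℓ
    have h1 : φ (S (WithLp.toLp 1 (z.fst, 0))) ≤ ‖z.fst‖ * ‖S (WithLp.toLp 1 (c m))‖ := by
      have := hs (F s 0) (hFs s 0) z.fst
      rw [hℓ, hℓ] at this
      exact this.trans (mul_le_mul_of_nonneg_left ((hle _).trans (hm (Sum.inl s))) (norm_nonneg _))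
    have h2 : φ (S (WithLp.toLp 1 (0, z.snd))) ≤ ‖z.snd‖ * ‖S (WithLp.toLp 1 (c m))‖ := by
      have := hj z.snd
      rw [hℓ, hℓ] at this
      refine this.trans (mul_le_mul_of_nonneg_left ((hle _).trans ?_) (norm_nonneg _))
      have h3 : WithLp.toLp 1 ((0 : C01), ((τ : ℤ) : ℝ) • normalizedIndicator (D.measurable j)) =
          ((τ : ℤ) : ℝ) • WithLp.toLp 1 (c (Sum.inr j)) := by
        rw [← WithLp.toLp_smul]
        simp [c]
      rw [h3, map_smul, norm_smul, Real.norm_eq_abs, abs_intUnit_cast, one_mul]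
      exact hm (Sum.inr j)
    have h3 : z = WithLp.toLp 1 (z.fst, 0) + WithLp.toLp 1 (0, z.snd) := by
      rw [← WithLp.toLp_add]
      simp
      rfl
    have h4 : φ (S z) = ‖S z‖ := by simpa using hφz
    rw [← h4]
    conv_lhs => rw [h3, map_add, map_add]
    rw [WithLp.prod_norm_eq_of_L1 z]
    linarith
  rcases m with s | j
  · -- the maximiser `F s 0` is replaced by `F s t`, with `t` adapted to the value of the operator
    obtain ⟨t, ht⟩ := exists_abs_apply_eq_norm (D.toFun (F s 0, 0)).1
    obtain ⟨θ, hθ, h⟩ := exists_norm_add_smul_ge (hFt s t) ht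
    have hcongr : D.toFun (F s 0, 0) = D.toFun (F s t, 0) :=
      D.toFun_congr_fst (fun i x hx => by rw [hFs s 0 i x hx, hFs s t i x hx]) 0
    have hFn : ‖F s t‖ = 1 := le_antisymm (hF1 s t) ((hFt s t).ge.trans
      ((F s t).norm_coe_le_norm t))
    refine mem_NRA_of_norm_add_eq (z := WithLp.toLp 1 (F s t, 0)) (θ := θ) ?_ hθ ?_
    · rw [WithLp.prod_norm_eq_of_L1]
      simp [hFn]
    · refine (add_le_add_right hbound 1).trans ?_
      simp only [c, Sum.elim_inl]
      rw [hS, hS, ← hcongr, WithLp.prod_norm_eq_of_L1, WithLp.prod_norm_eq_of_L1]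
      simp only [WithLp.add_fst, WithLp.add_snd, WithLp.smul_fst, WithLp.smul_snd,
        WithLp.toLp_fst, WithLp.toLp_snd, zero_add, norm_smul, Real.norm_eq_abs, hθ, one_mul]
      linarith
  · obtain ⟨θ, hθ, h⟩ := exists_norm_normalizedIndicator_add_eq (D.measurable j) j.2
      (D.snd_toFun_mem (0, normalizedIndicator (D.measurable j)))
    refine mem_NRA_of_norm_add_eq
      (z := WithLp.toLp 1 (0, normalizedIndicator (D.measurable j))) (θ := θ) ?_ hθ ?_
    · rw [WithLp.prod_norm_eq_of_L1]
      simp [norm_normalizedIndicator _ j.2]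
    · refine (add_le_add_right hbound 1).trans ?_
      simp only [c, Sum.elim_inr]
      rw [hS, WithLp.prod_norm_eq_of_L1, WithLp.prod_norm_eq_of_L1]
      simp only [WithLp.add_fst, WithLp.add_snd, WithLp.smul_fst, WithLp.smul_snd,
        WithLp.toLp_fst, WithLp.toLp_snd, zero_add, norm_smul, Real.norm_eq_abs, hθ, one_mul, h]
      linarith

theorem mem_NRA_sumInfty {S : SumInfty →L[ℝ] SumInfty}
    (hS : ∀ z : C01 × L101, S (WithLp.toLp ∞ z) = WithLp.toLp ∞ (D.toFun z)) :
    S ∈ NRA ℝ SumInfty := by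
  classical
  choose F hF1 hFs hFt using fun s => exists_continuousMap_eq_sign D.isClosed D.disjoint s
  obtain ⟨j₀, hj₀⟩ := exists_volume_preimage_singleton_ne_zero D.measurable
  have : Nonempty {j // volume (D.π ⁻¹' {j}) ≠ 0} := ⟨⟨j₀, hj₀⟩⟩
  let χ : ℤˣ × {j // volume (D.π ⁻¹' {j}) ≠ 0} → L101 := fun q =>
    ((q.1 : ℤ) : ℝ) • normalizedIndicator (D.measurable q.2)
  have hχ : ∀ q, ‖χ q‖ = 1 := fun q => by
    simp only [χ]
    rw [norm_smul, Real.norm_eq_abs, abs_intUnit_cast, norm_normalizedIndicator _ q.2.2, one_mul]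
  -- the finitely many candidates among which the norm is attained; the point `0` is arbitrary
  let c : (ι → ℤˣ) × ℤˣ × {j // volume (D.π ⁻¹' {j}) ≠ 0} → C01 × L101 :=
    fun q => (F q.1 0, χ q.2)
  obtain ⟨⟨s, q⟩, hm⟩ := Finite.exists_max fun m => ‖S (WithLp.toLp ∞ (c m))‖
  have hbound : ‖S‖ ≤ ‖S (WithLp.toLp ∞ (c (s, q)))‖ := by
    refine S.opNorm_le_bound (norm_nonneg _) fun z => ?_
    obtain ⟨φ, hφ, hφz⟩ := exists_dual_vector'' ℝ (S z)
    let ℓ : C01 × L101 →ₗ[ℝ] ℝ :=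
      φ.toLinearMap ∘ₗ (WithLp.linearEquiv ∞ ℝ (C01 × L101)).symm.toLinearMap
    have hℓ : ∀ w, ℓ (D.toFun w) = φ (S (WithLp.toLp ∞ w)) := fun w => by rw [hS]; rfl
    have hle : ∀ w, φ w ≤ ‖w‖ := fun w =>
      (le_abs_self _).trans ((φ.le_opNorm w).trans (mul_le_of_le_one_left (norm_nonneg _) hφ))
    obtain ⟨s', hs⟩ := D.exists_sign_le ℓ
    obtain ⟨j, τ, hj⟩ := D.exists_normalizedIndicator_le ℓ
    have hadd : ∀ f g, φ (S (WithLp.toLp ∞ (f, g))) =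
        φ (S (WithLp.toLp ∞ (f, 0))) + φ (S (WithLp.toLp ∞ (0, g))) := fun f g => by
      rw [← map_add, ← map_add, ← WithLp.toLp_add]
      simp
    have h1 := hs (F s' 0) (hFs s' 0)
    have h2 := hj
    simp only [hℓ] at h1 h2
    -- the two maximal values are nonnegative, since the unit balls are symmetric
    have h1z : 0 ≤ φ (S (WithLp.toLp ∞ (F s' 0, 0))) := by
      have hz := h1 (-F s' 0)
      have hneg : WithLp.toLp ∞ (-F s' 0, (0 : L101)) = -WithLp.toLp ∞ (F s' 0, (0 : L101)) := by
        rw [← WithLp.toLp_neg]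
        simp
      rw [hneg, map_neg, map_neg, norm_neg] at hz
      by_contra! hneg
      linarith [mul_nonpos_of_nonneg_of_nonpos (norm_nonneg (F s' 0)) hneg.le]
    have h2z : 0 ≤ φ (S (WithLp.toLp ∞ (0, χ (τ, j)))) := by
      have hz := h2 (-χ (τ, j))
      have hneg : WithLp.toLp ∞ ((0 : C01), -χ (τ, j)) = -WithLp.toLp ∞ ((0 : C01), χ (τ, j)) := by
        rw [← WithLp.toLp_neg]
        simp
      rw [hneg, map_neg, map_neg, norm_neg, hχ] at hz
      change _ ≤ 1 * φ (S (WithLp.toLp ∞ (0, χ (τ, j)))) at hz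
      linarith
    have h4 : φ (S z) = ‖S z‖ := by simpa using hφz
    rw [← h4]
    calc φ (S z) = φ (S (WithLp.toLp ∞ (z.fst, 0))) + φ (S (WithLp.toLp ∞ (0, z.snd))) :=
          hadd z.fst z.snd
      _ ≤ ‖z.fst‖ * φ (S (WithLp.toLp ∞ (F s' 0, 0))) +
          ‖z.snd‖ * φ (S (WithLp.toLp ∞ (0, χ (τ, j)))) := add_le_add (h1 _) (h2 _)
      _ ≤ ‖z‖ * φ (S (WithLp.toLp ∞ (F s' 0, 0))) +
          ‖z‖ * φ (S (WithLp.toLp ∞ (0, χ (τ, j)))) :=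
        add_le_add (mul_le_mul_of_nonneg_right (WithLp.norm_fst_le _ z) h1z)
          (mul_le_mul_of_nonneg_right (WithLp.norm_snd_le _ z) h2z)
      _ = ‖z‖ * φ (S (WithLp.toLp ∞ (c (s', (τ, j))))) := by
        rw [← mul_add, ← hadd]
      _ ≤ ‖z‖ * ‖S (WithLp.toLp ∞ (c (s, q)))‖ :=
        mul_le_mul_of_nonneg_left ((hle _).trans (hm _)) (norm_nonneg _)
      _ = ‖S (WithLp.toLp ∞ (c (s, q)))‖ * ‖z‖ := mul_comm _ _
  -- the maximiser `F s 0` is replaced by `F s t`, with `t` adapted to the value of the operator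
  obtain ⟨t, ht⟩ := exists_abs_apply_eq_norm (D.toFun (c (s, q))).1
  have hcongr : D.toFun (c (s, q)) = D.toFun (F s t, χ q) :=
    D.toFun_congr_fst (fun i x hx => by rw [hFs s 0 i x hx, hFs s t i x hx]) _
  have hFn : ‖F s t‖ = 1 := le_antisymm (hF1 s t) ((hFt s t).ge.trans
    ((F s t).norm_coe_le_norm t))
  have hz : ‖WithLp.toLp ∞ (F s t, χ q)‖ = 1 := by
    rw [WithLp.prod_norm_eq_sup]
    simp [hFn, hχ]
  rw [hS, WithLp.prod_norm_eq_sup] at hbound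
  rcases le_total ‖(D.toFun (c (s, q))).2‖ ‖(D.toFun (c (s, q))).1‖ with hle | hle
  · obtain ⟨θ, hθ, h⟩ := exists_norm_add_smul_ge (hFt s t) ht
    refine mem_NRA_of_norm_add_eq hz hθ ?_
    refine (add_le_add_right (hbound.trans_eq (sup_eq_left.2 hle)) 1).trans (h.trans ?_)
    rw [hS, ← hcongr]
    exact WithLp.norm_fst_le _ (WithLp.toLp ∞ (F s t, χ q) + θ • WithLp.toLp ∞ (D.toFun (c (s, q))))
  · obtain ⟨θ, hθ, h⟩ := exists_norm_normalizedIndicator_add_eq (D.measurable q.2) q.2.2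
      (D.snd_toFun_mem (c (s, q)))
    have hθ' : |((q.1 : ℤ) : ℝ) * θ| = 1 := by rw [abs_mul, hθ, abs_intUnit_cast, one_mul]
    refine mem_NRA_of_norm_add_eq hz hθ' ?_
    refine (add_le_add_right (hbound.trans_eq (sup_eq_right.2 hle)) 1).trans ?_
    simp only [WithLp.toLp_snd]
    have h' : ‖χ q + (((q.1 : ℤ) : ℝ) * θ) • (D.toFun (c (s, q))).2‖ =
        1 + ‖(D.toFun (c (s, q))).2‖ := by
      rw [← h, ← smul_smul, ← smul_add, norm_smul, Real.norm_eq_abs, abs_intUnit_cast, one_mul]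
    rw [← h', hS, ← hcongr]
    exact WithLp.norm_snd_le _ (WithLp.toLp ∞ (F s t, χ q) +
      (((q.1 : ℤ) : ℝ) * θ) • WithLp.toLp ∞ (D.toFun (c (s, q))))

end SimpleOperatorData

/-! ### Functionals on spaces of continuous functions -/

section Jordan

open scoped NNReal Pointwise CompactlySupported

variable {X : Type*} [TopologicalSpace X]

/-- The Riesz decomposition property of `C(X)`. -/
theorem Icc_zero_add_eq (f g : C(X, ℝ)) (hf : 0 ≤ f) (hg : 0 ≤ g) :
    Set.Icc 0 (f + g) = Set.Icc 0 f + Set.Icc 0 g := by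
  ext h
  constructor
  · rintro ⟨h0, h1⟩
    refine ⟨h ⊓ f, ⟨le_inf h0 hf, inf_le_right⟩, h - h ⊓ f, ⟨?_, ?_⟩, by simp⟩
    · exact sub_nonneg.2 inf_le_left
    · rw [sub_le_iff_le_add, inf_comm, add_comm g]
      refine ContinuousMap.le_def.2 fun x => ?_
      have hx : h x ≤ f x + g x := ContinuousMap.le_def.1 h1 x
      simp only [ContinuousMap.add_apply, ContinuousMap.inf_apply]
      rcases le_total (f x) (h x) with h' | h'
      · rwa [min_eq_left h']
      · rw [min_eq_right h']
        exact le_add_of_nonneg_right (ContinuousMap.le_def.1 hg x)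
  · rintro ⟨a, ⟨ha0, ha1⟩, b, ⟨hb0, hb1⟩, rfl⟩
    exact ⟨add_nonneg ha0 hb0, add_le_add ha1 hb1⟩

/-- The positive part of a functional on `C(X)`, evaluated at a function `f ≥ 0`:
the supremum of `μ g` over `0 ≤ g ≤ f`. -/
noncomputable def posPartFun (μ : StrongDual ℝ C(X, ℝ)) (f : C(X, ℝ)) : ℝ :=
  sSup (μ '' Set.Icc 0 f)

theorem posPartFun_smul (μ : StrongDual ℝ C(X, ℝ)) {c : ℝ} (hc : 0 ≤ c) (f : C(X, ℝ)) :
    posPartFun μ (c • f) = c * posPartFun μ f := by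
  rcases hc.eq_or_lt with rfl | hc
  · simp [posPartFun]
  · have : Set.Icc 0 (c • f) = c • Set.Icc 0 f := by
      ext g
      rw [Set.mem_smul_set_iff_inv_smul_mem₀ hc.ne']
      constructor
      · rintro ⟨h0, h1⟩
        refine ⟨ContinuousMap.le_def.2 fun x => mul_nonneg (inv_nonneg.2 hc.le)
          (ContinuousMap.le_def.1 h0 x), ContinuousMap.le_def.2 fun x => ?_⟩
        exact (inv_mul_le_iff₀ hc).2 (ContinuousMap.le_def.1 h1 x)
      · rintro ⟨h0, h1⟩
        refine ⟨ContinuousMap.le_def.2 fun x => ?_, ContinuousMap.le_def.2 fun x => ?_⟩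
        · exact (mul_nonneg_iff_of_pos_left (inv_pos.2 hc)).1 (ContinuousMap.le_def.1 h0 x)
        · exact (inv_mul_le_iff₀ hc).1 (ContinuousMap.le_def.1 h1 x)
    rw [posPartFun, this, Set.image_smul_comm _ _ _ (fun g => map_smul μ c g),
      Real.sSup_smul_of_nonneg hc.le]
    rfl

variable [CompactSpace X]

theorem bddAbove_image_Icc (μ : StrongDual ℝ C(X, ℝ)) (f : C(X, ℝ)) :
    BddAbove (μ '' Set.Icc 0 f) := by
  refine ⟨‖μ‖ * ‖f‖, ?_⟩
  rintro _ ⟨g, ⟨hg0, hgf⟩, rfl⟩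
  refine (le_abs_self _).trans ((μ.le_opNorm g).trans ?_)
  refine mul_le_mul_of_nonneg_left ?_ (norm_nonneg _)
  refine (ContinuousMap.norm_le _ (norm_nonneg _)).2 fun x => ?_
  rw [Real.norm_of_nonneg (ContinuousMap.le_def.1 hg0 x)]
  exact (ContinuousMap.le_def.1 hgf x).trans ((le_abs_self _).trans (f.norm_coe_le_norm x))

theorem posPartFun_nonneg (μ : StrongDual ℝ C(X, ℝ)) {f : C(X, ℝ)} (hf : 0 ≤ f) :
    0 ≤ posPartFun μ f :=
  le_csSup (bddAbove_image_Icc μ f) ⟨0, ⟨le_rfl, hf⟩, map_zero μ⟩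

theorem posPartFun_add (μ : StrongDual ℝ C(X, ℝ)) {f g : C(X, ℝ)} (hf : 0 ≤ f) (hg : 0 ≤ g) :
    posPartFun μ (f + g) = posPartFun μ f + posPartFun μ g := by
  rw [posPartFun, Icc_zero_add_eq f g hf hg, Set.image_add,
    csSup_add ((Set.nonempty_Icc.2 hf).image μ) (bddAbove_image_Icc μ f)
      ((Set.nonempty_Icc.2 hg).image μ) (bddAbove_image_Icc μ g)]
  rfl

/-- The Jordan decomposition on the positive cone. -/
theorem posPartFun_sub_posPartFun_neg (μ : StrongDual ℝ C(X, ℝ)) {f : C(X, ℝ)} (hf : 0 ≤ f) :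
    posPartFun μ f - posPartFun (-μ) f = μ f := by
  have h : (-μ) '' Set.Icc 0 f = {-μ f} + μ '' Set.Icc 0 f := by
    have h1 : Set.Icc 0 f = (fun g => f - g) '' Set.Icc 0 f := by simp
    conv_lhs => rw [h1]
    rw [Set.image_image, Set.singleton_add, Set.image_image]
    refine Set.image_congr fun g _ => ?_
    simp
    ring
  have h2 : posPartFun (-μ) f = -μ f + posPartFun μ f := by
    rw [posPartFun, h, csSup_add (Set.singleton_nonempty _) (bddAbove_singleton)
      ((Set.nonempty_Icc.2 hf).image μ) (bddAbove_image_Icc μ f), csSup_singleton]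
    rfl
  rw [h2]
  ring

variable [T2Space X] [MeasurableSpace X] [BorelSpace X]

/-- The positive part is additive and positively homogeneous on the positive cone, so it is the
integral with respect to a measure. -/
theorem exists_measure_posPartFun (μ : StrongDual ℝ C(X, ℝ)) :
    ∃ ν : Measure X, IsFiniteMeasure ν ∧ ∀ f : C(X, ℝ), 0 ≤ f → ∫ x, f x ∂ν = posPartFun μ f := by
  have hpos : ∀ f : C_c(X, ℝ≥0), 0 ≤ (f.toReal : C(X, ℝ)) := fun f =>
    ContinuousMap.le_def.2 fun x => by simp
  let Λ : C_c(X, ℝ≥0) →ₗ[ℝ≥0] ℝ≥0 :=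
    { toFun := fun f => ⟨posPartFun μ f.toReal, posPartFun_nonneg μ (hpos f)⟩
      map_add' := fun f g => NNReal.eq (by
        refine Eq.trans ?_ (posPartFun_add μ (hpos f) (hpos g))
        change posPartFun μ _ = _
        congr 1
        ext x
        simp)
      map_smul' := fun c f => NNReal.eq (by
        refine Eq.trans ?_ (posPartFun_smul μ c.2 f.toReal)
        change posPartFun μ _ = _
        congr 1
        ext x
        simp [NNReal.smul_def]) }
  refine ⟨NNRealRMK.rieszMeasure Λ, ⟨isCompact_univ.measure_lt_top⟩, fun f hf => ?_⟩
  let f' : C_c(X, ℝ≥0) := ⟨⟨fun x => ⟨f x, ContinuousMap.le_def.1 hf x⟩, by fun_prop⟩,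
    HasCompactSupport.of_compactSpace _⟩
  refine (NNRealRMK.integral_rieszMeasure Λ f').trans ?_
  change posPartFun μ _ = _
  congr 1
  ext x
  exact CompactlySupportedContinuousMap.toReal_apply f' x

/-- The **Riesz representation theorem** for signed functionals, as a difference of measures. -/
theorem exists_measure_sub_measure (μ : StrongDual ℝ C(X, ℝ)) :
    ∃ ν₁ ν₂ : Measure X, IsFiniteMeasure ν₁ ∧ IsFiniteMeasure ν₂ ∧
      ∀ f : C(X, ℝ), μ f = ∫ x, f x ∂ν₁ - ∫ x, f x ∂ν₂ := by
  obtain ⟨ν₁, h₁, e₁⟩ := exists_measure_posPartFun μ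
  obtain ⟨ν₂, h₂, e₂⟩ := exists_measure_posPartFun (-μ)
  have hint : ∀ (ν : Measure X) [IsFiniteMeasure ν] (f : C(X, ℝ)), Integrable (fun x => f x) ν :=
    fun ν _ f => f.continuous.integrable_of_hasCompactSupport (HasCompactSupport.of_compactSpace _)
  have key : ∀ f : C(X, ℝ), 0 ≤ f → μ f = ∫ x, f x ∂ν₁ - ∫ x, f x ∂ν₂ := fun f hf => by
    rw [e₁ f hf, e₂ f hf, posPartFun_sub_posPartFun_neg μ hf]
  refine ⟨ν₁, ν₂, h₁, h₂, fun f => ?_⟩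
  have hf : f = (f ⊔ 0) - (-f) ⊔ 0 := by
    ext x
    simp only [ContinuousMap.sub_apply, ContinuousMap.sup_apply, ContinuousMap.neg_apply,
      ContinuousMap.zero_apply]
    rcases le_total (f x) 0 with h | h
    · simp [h]
    · simp [h]
  have h : ∀ (ν : Measure X) [IsFiniteMeasure ν],
      ∫ x, f x ∂ν = ∫ x, (f ⊔ 0) x ∂ν - ∫ x, ((-f) ⊔ 0) x ∂ν := fun ν _ => by
    rw [← integral_sub (hint ν _) (hint ν _)]
    conv_lhs => rw [hf]
    rfl
  conv_lhs => rw [hf]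
  rw [map_sub, key _ le_sup_right, key _ le_sup_right, h ν₁, h ν₂]
  ring

/-- Finitely many functionals on `C(X)` have bounded densities with respect to a common finite
measure. -/
theorem exists_common_density {k : Type*} [Fintype k] (μ : k → StrongDual ℝ C(X, ℝ)) :
    ∃ ν : Measure X, IsFiniteMeasure ν ∧ ∃ g : k → X → ℝ, (∀ m, Measurable (g m)) ∧
      (∀ m x, |g m x| ≤ 1) ∧ ∀ m (f : C(X, ℝ)), μ m f = ∫ x, f x * g m x ∂ν := by
  choose ν₁ ν₂ h₁ h₂ h using fun m => exists_measure_sub_measure (μ m)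
  let ν : Measure X := ∑ m, (ν₁ m + ν₂ m)
  have hle₁ : ∀ m, ν₁ m ≤ ν := fun m =>
    (Measure.le_add_right le_rfl).trans
      (Finset.single_le_sum (f := fun m => ν₁ m + ν₂ m) (fun _ _ => Measure.zero_le _)
        (Finset.mem_univ m))
  have hle₂ : ∀ m, ν₂ m ≤ ν := fun m =>
    (Measure.le_add_left le_rfl).trans
      (Finset.single_le_sum (f := fun m => ν₁ m + ν₂ m) (fun _ _ => Measure.zero_le _)
        (Finset.mem_univ m))
  have hν : IsFiniteMeasure ν := inferInstance
  let d : Measure X → X → ℝ := fun ρ x => min (ρ.rnDeriv ν x).toReal 1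
  have hdm : ∀ ρ, Measurable (d ρ) := fun ρ =>
    (Measure.measurable_rnDeriv ρ ν).ennreal_toReal.min measurable_const
  have hd0 : ∀ ρ x, 0 ≤ d ρ x := fun ρ x => le_min ENNReal.toReal_nonneg zero_le_one
  have hd1 : ∀ ρ x, d ρ x ≤ 1 := fun ρ x => min_le_right _ _
  have hd : ∀ (ρ : Measure X) [IsFiniteMeasure ρ], ρ ≤ ν → ∀ f : C(X, ℝ),
      ∫ x, f x ∂ρ = ∫ x, f x * d ρ x ∂ν := by
    intro ρ _ hρ f
    rw [← integral_rnDeriv_smul (Measure.absolutelyContinuous_of_le hρ)]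
    refine integral_congr_ae ?_
    filter_upwards [Measure.rnDeriv_le_one_of_le hρ] with x hx
    have : (ρ.rnDeriv ν x).toReal ≤ 1 :=
      ENNReal.toReal_le_of_le_ofReal zero_le_one (by simpa using hx)
    simp only [d, min_eq_left this, smul_eq_mul]
    ring
  have hint : ∀ ρ (f : C(X, ℝ)), Integrable (fun x => f x * d ρ x) ν := fun ρ f => by
    refine (f.continuous.integrable_of_hasCompactSupport
      (HasCompactSupport.of_compactSpace _)).mul_bdd (c := 1) (hdm ρ).aestronglyMeasurable ?_
    exact Filter.Eventually.of_forall fun x => by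
      rw [Real.norm_of_nonneg (hd0 ρ x)]
      exact hd1 ρ x
  refine ⟨ν, hν, fun m x => d (ν₁ m) x - d (ν₂ m) x, fun m => (hdm _).sub (hdm _), fun m x => ?_,
    fun m f => ?_⟩
  · rw [abs_le]
    constructor <;> linarith [hd0 (ν₁ m) x, hd1 (ν₁ m) x, hd0 (ν₂ m) x, hd1 (ν₂ m) x]
  · rw [h, hd _ (hle₁ m), hd _ (hle₂ m), ← integral_sub (hint _ f) (hint _ f)]
    simp only [mul_sub]

end Jordan

/-! ### Approximation of densities by step functions -/

section Partition

variable {X k : Type} [MeasurableSpace X] [Fintype k]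

/-- The partition consists of the sets on which all the `⌊h m x / η⌋` are constant. -/
theorem exists_partition_abs_sub_le {h : k → X → ℝ} (hm : ∀ m, Measurable (h m)) {C : ℝ}
    (hC : ∀ m x, |h m x| ≤ C) {η : ℝ} (hη : 0 < η) :
    ∃ (κ : Type) (_ : Fintype κ) (π : X → κ) (c : k → κ → ℝ), (∀ j, MeasurableSet (π ⁻¹' {j})) ∧
      ∀ m x, |h m x - c m (π x)| ≤ η := by
  classical
  let q : X → k → ℤ := fun x m => ⌊h m x / η⌋
  have hq : Measurable q := measurable_pi_lambda _ fun m => ((hm m).div_const η).floor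
  have hfin : (Set.range q).Finite := by
    refine (Set.finite_Icc (fun _ => ⌊-C / η⌋) (fun _ => ⌊C / η⌋)).subset ?_
    rintro _ ⟨x, rfl⟩
    have := fun m => abs_le.1 (hC m x)
    exact ⟨fun m => Int.floor_le_floor (div_le_div_of_nonneg_right (this m).1 hη.le),
      fun m => Int.floor_le_floor (div_le_div_of_nonneg_right (this m).2 hη.le)⟩
  refine ⟨Set.range q, hfin.fintype, Set.rangeFactorization q, fun m j => η * j.1 m, ?_, ?_⟩
  · intro j
    have : Set.rangeFactorization q ⁻¹' {j} = q ⁻¹' {j.1} := by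
      ext x
      simp [Set.rangeFactorization, Subtype.ext_iff]
    rw [this]
    exact hq (measurableSet_singleton _)
  · intro m x
    change |h m x - η * (⌊h m x / η⌋ : ℤ)| ≤ η
    have h1 := (le_div_iff₀ hη).1 (Int.floor_le (h m x / η))
    have h2 := (div_lt_iff₀ hη).1 (Int.lt_floor_add_one (h m x / η))
    rw [abs_le]
    constructor <;> nlinarith

/-- Finitely many functionals on `C[0,1]` are simultaneously approximated in norm by combinations of
integrals over disjoint closed sets: each level set of the densities is exhausted from inside by a
closed set. -/
theorem exists_closed_sets_abs_sub_le (μ : k → StrongDual ℝ C01) {ε : ℝ} (hε : 0 < ε) :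
    ∃ (ι : Type) (_ : Fintype ι) (ν : Measure I) (_ : IsFiniteMeasure ν) (K : ι → Set I)
      (c : k → ι → ℝ), (∀ i, IsClosed (K i)) ∧ (Pairwise fun i j => Disjoint (K i) (K j)) ∧
      ∀ m f, |μ m f - ∑ i, (∫ x in K i, f x ∂ν) * c m i| ≤ ε * ‖f‖ := by
  obtain ⟨ν, hν, g, hgm, hg1, hg⟩ := exists_common_density μ
  set M := ν.real Set.univ with hM
  have hM0 : 0 ≤ M := measureReal_nonneg
  obtain ⟨ι, _, π, c, hπ, hc⟩ := exists_partition_abs_sub_le hgm hg1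
    (show 0 < ε / 2 / (M + 1) by positivity)
  set N : ℝ := ∑ m, ∑ i, |c m i| with hN
  have hN0 : 0 ≤ N := Finset.sum_nonneg fun m _ => Finset.sum_nonneg fun i _ => abs_nonneg _
  -- the coefficients are known before the closed sets are chosen, so `δ` may depend on them
  set δ : ℝ := ε / 2 / (N + 1) with hδ
  have hδ0 : 0 < δ := by positivity
  have hK : ∀ i, ∃ K ⊆ π ⁻¹' {i}, IsClosed K ∧ ν (π ⁻¹' {i} \ K) < ENNReal.ofReal δ := fun i =>
    (hπ i).exists_isClosed_sdiff_lt (measure_ne_top ν _) (ENNReal.ofReal_pos.2 hδ0).ne'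
  choose K hKs hKc hKν using hK
  refine ⟨ι, inferInstance, ν, hν, K, c, hKc, fun i j hij => ?_, fun m f => ?_⟩
  · exact (Disjoint.preimage π (Set.disjoint_singleton.2 hij)).mono (hKs i) (hKs j)
  have hf : Integrable (fun x => f x) ν :=
    f.continuous.integrable_of_hasCompactSupport (HasCompactSupport.of_compactSpace _)
  have hfg : Integrable (fun x => f x * g m x) ν :=
    hf.mul_bdd (c := 1) (hgm m).aestronglyMeasurable (Filter.Eventually.of_forall (hg1 m))
  have hpiece : ∀ i, |∫ x in π ⁻¹' {i}, f x * g m x ∂ν - (∫ x in K i, f x ∂ν) * c m i| ≤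
      ‖f‖ * (ε / 2 / (M + 1)) * ν.real (π ⁻¹' {i}) + |c m i| * (‖f‖ * δ) := by
    intro i
    have e1 : ∫ x in π ⁻¹' {i}, f x * g m x ∂ν - (∫ x in K i, f x ∂ν) * c m i =
        ∫ x in π ⁻¹' {i}, f x * (g m x - c m i) ∂ν +
          c m i * ∫ x in π ⁻¹' {i} \ K i, f x ∂ν := by
      rw [setIntegral_sdiff (hKc i).measurableSet hf.integrableOn (hKs i)]
      simp only [mul_sub]
      rw [integral_sub hfg.integrableOn (hf.mul_const _).integrableOn, integral_mul_const]
      ring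
    have h1 : |∫ x in π ⁻¹' {i}, f x * (g m x - c m i) ∂ν| ≤
        ‖f‖ * (ε / 2 / (M + 1)) * ν.real (π ⁻¹' {i}) := by
      refine norm_setIntegral_le_of_norm_le_const (f := fun x => f x * (g m x - c m i))
        (measure_lt_top ν _) fun x hx => ?_
      rw [norm_mul]
      have := hc m x
      rw [show π x = i from hx] at this
      exact mul_le_mul (f.norm_coe_le_norm x) this (norm_nonneg _) (norm_nonneg _)
    have h2 : |∫ x in π ⁻¹' {i} \ K i, f x ∂ν| ≤ ‖f‖ * δ := by
      refine (norm_setIntegral_le_of_norm_le_const (measure_lt_top ν _) fun x _ =>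
        f.norm_coe_le_norm x).trans ?_
      refine mul_le_mul_of_nonneg_left ?_ (norm_nonneg _)
      exact ENNReal.toReal_le_of_le_ofReal hδ0.le (hKν i).le
    rw [e1]
    refine (abs_add_le _ _).trans (add_le_add h1 ?_)
    rw [abs_mul]
    exact mul_le_mul_of_nonneg_left h2 (abs_nonneg _)
  rw [hg, ← sum_setIntegral_preimage_singleton hπ hfg, ← Finset.sum_sub_distrib]
  refine (Finset.abs_sum_le_sum_abs _ _).trans
    ((Finset.sum_le_sum fun i _ => hpiece i).trans ?_)
  rw [Finset.sum_add_distrib, ← Finset.mul_sum, ← Finset.sum_mul,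
    sum_measureReal_preimage_singleton hπ, ← hM]
  have hN1 : ∑ i, |c m i| ≤ N :=
    Finset.single_le_sum (f := fun m => ∑ i, |c m i|)
      (fun m _ => Finset.sum_nonneg fun i _ => abs_nonneg _) (Finset.mem_univ m)
  have h1 : ε / 2 / (M + 1) * M ≤ ε / 2 := by
    rw [div_mul_eq_mul_div]
    exact div_le_of_le_mul₀ (by positivity) (by positivity) (by nlinarith)
  have h2 : N * δ ≤ ε / 2 := by
    rw [hδ, mul_div_assoc']
    exact div_le_of_le_mul₀ (by positivity) (by positivity) (by nlinarith)
  have h3 := mul_le_mul_of_nonneg_left h1 (norm_nonneg f)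
  have h4 := mul_le_mul_of_nonneg_left h2 (norm_nonneg f)
  have h5 := mul_le_mul_of_nonneg_right hN1 (mul_nonneg (norm_nonneg f) hδ0.le)
  linarith

end Partition

/-! ### Functionals on integrable functions -/

/-- Every functional on `L₁[0,1]` is given by a bounded density. It is found by restricting the
functional to the Hilbert space `L₂[0,1]`. -/
theorem exists_bounded_density (ψ : StrongDual ℝ L101) :
    ∃ h : I → ℝ, Measurable h ∧ (∀ x, |h x| ≤ ‖ψ‖) ∧ ∀ g : L101, ψ g = ∫ x, g x * h x := by
  let one : Lp ℝ 2 (volume : Measure I) := Lp.const 2 volume 1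
  let incl : Lp ℝ 2 (volume : Measure I) →L[ℝ] L101 :=
    (ContinuousLinearMap.mul ℝ ℝ).holderL volume 2 2 1 one
  have hincl : ∀ f : Lp ℝ 2 (volume : Measure I), incl f =ᵐ[volume] f := fun f => by
    filter_upwards [(ContinuousLinearMap.mul ℝ ℝ).coeFn_holder (r := 1) one f,
      Lp.coeFn_const (p := 2) (μ := volume) (1 : ℝ)] with x h1 h2
    refine h1.trans ?_
    simp only [one, h2]
    simp
  let h : Lp ℝ 2 (volume : Measure I) := (InnerProductSpace.toDual ℝ _).symm (ψ ∘L incl)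
  have hh : ∀ (A : Set I) (hA : MeasurableSet A) (c : ℝ),
      ψ (indicatorConstLp 1 hA (measure_ne_top volume A) c) = c * ∫ x in A, h x := by
    intro A hA c
    have h1 : incl (indicatorConstLp 2 hA (measure_ne_top volume A) c) =
        indicatorConstLp 1 hA (measure_ne_top volume A) c := by
      refine Lp.ext ((hincl _).trans ?_)
      exact indicatorConstLp_coeFn.trans indicatorConstLp_coeFn.symm
    have h2 : inner ℝ h (indicatorConstLp 2 hA (measure_ne_top volume A) c) =
        ψ (incl (indicatorConstLp 2 hA (measure_ne_top volume A) c)) :=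
      InnerProductSpace.toDual_symm_apply
    rw [← h1, ← h2, real_inner_comm, L2.inner_indicatorConstLp_eq_inner_setIntegral]
    simp [mul_comm]
  have hint : Integrable h volume := (Lp.memLp h).integrable (by norm_num)
  have hle : ∀ A, MeasurableSet A → |∫ x in A, h x| ≤ ‖ψ‖ * volume.real A := by
    intro A hA
    have := hh A hA 1
    rw [one_mul] at this
    rw [← this]
    refine (ψ.le_opNorm _).trans_eq ?_
    rw [norm_indicatorConstLp one_ne_zero ENNReal.one_ne_top]
    simp
  have hup : ∀ᵐ x ∂(volume : Measure I), h x ≤ ‖ψ‖ := by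
    refine ae_le_of_forall_setIntegral_le hint (integrable_const _) fun A hA _ => ?_
    rw [setIntegral_const, smul_eq_mul, mul_comm]
    exact (le_abs_self _).trans (hle A hA)
  have hlow : ∀ᵐ x ∂(volume : Measure I), -‖ψ‖ ≤ h x := by
    refine ae_le_of_forall_setIntegral_le (integrable_const _) hint fun A hA _ => ?_
    rw [setIntegral_const, smul_eq_mul]
    linarith [neg_abs_le (∫ x in A, h x), hle A hA]
  -- a representative which is bounded everywhere
  let h' : I → ℝ := fun x => max (-‖ψ‖) (min (h x) ‖ψ‖)
  have hh' : h' =ᵐ[volume] h := by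
    filter_upwards [hup, hlow] with x h1 h2
    simp only [h']
    rw [min_eq_left h1, max_eq_right h2]
  have hm : Measurable h' := measurable_const.max
    ((Lp.stronglyMeasurable h).measurable.min measurable_const)
  have hb : ∀ x, |h' x| ≤ ‖ψ‖ := fun x =>
    abs_le.2 ⟨le_max_left _ _, max_le (by linarith [norm_nonneg ψ]) (min_le_right _ _)⟩
  have hgi : ∀ g : L101, Integrable (fun x => g x * h' x) volume := fun g =>
    (L1.integrable_coeFn g).mul_bdd (c := ‖ψ‖) hm.aestronglyMeasurable
      (Filter.Eventually.of_forall hb)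
  let Φ : StrongDual ℝ L101 := LinearMap.mkContinuous
    { toFun := fun g => ∫ x, g x * h' x
      map_add' := fun g g' => by
        rw [← integral_add (hgi g) (hgi g')]
        refine integral_congr_ae ?_
        filter_upwards [Lp.coeFn_add g g'] with x hx
        rw [hx, Pi.add_apply, add_mul]
      map_smul' := fun c g => by
        rw [RingHom.id_apply, smul_eq_mul, ← integral_const_mul]
        refine integral_congr_ae ?_
        filter_upwards [Lp.coeFn_smul c g] with x hx
        rw [hx, Pi.smul_apply, smul_eq_mul, mul_assoc] } ‖ψ‖ fun g => by
      rw [L1.norm_eq_integral_norm, ← integral_const_mul]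
      refine norm_integral_le_of_norm_le ((L1.integrable_coeFn g).norm.const_mul _)
        (Filter.Eventually.of_forall fun x => ?_)
      rw [norm_mul, mul_comm]
      exact mul_le_mul_of_nonneg_right (hb x) (norm_nonneg _)
  refine ⟨h', hm, hb, fun g => ?_⟩
  change ψ g = Φ g
  refine Lp.induction ENNReal.one_ne_top (motive := fun g => ψ g = Φ g) ?_ ?_ ?_ g
  · intro c A hA hAv
    change ψ (indicatorConstLp 1 hA (measure_ne_top volume A) c) =
      ∫ x, indicatorConstLp 1 hA (measure_ne_top volume A) c x * h' x
    rw [hh A hA c, ← integral_const_mul, ← integral_indicator hA]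
    refine integral_congr_ae ?_
    filter_upwards [indicatorConstLp_coeFn (p := 1) (hs := hA) (hμs := measure_ne_top volume A)
      (c := c), hh'] with x h1 h2
    rw [h1, h2]
    by_cases hx : x ∈ A <;> simp [hx]
  · intro f g hf hg _ h1 h2
    rw [map_add, map_add, h1, h2]
  · exact isClosed_eq ψ.continuous Φ.continuous

/-- Finitely many functionals on `L₁[0,1]` are simultaneously approximated in norm by combinations
of integrals over the pieces of a partition, which can be chosen to refine the given one, `π₀`. -/
theorem exists_refinement_abs_sub_le {k κ₀ : Type} [Fintype k] [Fintype κ₀]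
    (ψ : k → StrongDual ℝ L101) {π₀ : I → κ₀} (hπ₀ : ∀ j, MeasurableSet (π₀ ⁻¹' {j}))
    {ε : ℝ} (hε : 0 < ε) :
    ∃ (κ : Type) (_ : Fintype κ) (π : I → κ₀ × κ) (c : k → κ₀ × κ → ℝ),
      (∀ j, MeasurableSet (π ⁻¹' {j})) ∧ (∀ x, (π x).1 = π₀ x) ∧
      ∀ m g, |ψ m g - ∑ j, (∫ x in π ⁻¹' {j}, g x) * c m j| ≤ ε * ‖g‖ := by
  choose h hm hb hψ using fun m => exists_bounded_density (ψ m)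
  obtain ⟨κ, _, π₁, c, hπ₁, hc⟩ := exists_partition_abs_sub_le hm (C := ∑ m, ‖ψ m‖)
    (fun m x => (hb m x).trans (Finset.single_le_sum (f := fun m => ‖ψ m‖)
      (fun _ _ => norm_nonneg _) (Finset.mem_univ m))) hε
  let π : I → κ₀ × κ := fun x => (π₀ x, π₁ x)
  have hπ : ∀ j, MeasurableSet (π ⁻¹' {j}) := fun j => by
    have : π ⁻¹' {j} = π₀ ⁻¹' {j.1} ∩ π₁ ⁻¹' {j.2} := by
      ext x
      simp [π, Prod.ext_iff]
    rw [this]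
    exact (hπ₀ _).inter (hπ₁ _)
  refine ⟨κ, inferInstance, π, fun m j => c m j.2, hπ, fun _ => rfl, fun m g => ?_⟩
  have hg := L1.integrable_coeFn g
  have hgi : Integrable (fun x => g x * h m x) volume :=
    hg.mul_bdd (c := ‖ψ m‖) (hm m).aestronglyMeasurable (Filter.Eventually.of_forall (hb m))
  rw [hψ, ← sum_setIntegral_preimage_singleton hπ hgi, ← Finset.sum_sub_distrib,
    L1.norm_eq_integral_norm, ← sum_setIntegral_preimage_singleton hπ hg.norm, Finset.mul_sum]
  refine (Finset.abs_sum_le_sum_abs _ _).trans (Finset.sum_le_sum fun j _ => ?_)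
  rw [← integral_mul_const, ← integral_sub hgi.integrableOn (hg.mul_const _).integrableOn,
    ← integral_const_mul]
  refine norm_integral_le_of_norm_le (f := fun x => g x * h m x - g x * c m j.2)
    (hg.norm.const_mul ε).integrableOn ?_
  refine (ae_restrict_iff' (hπ j)).2 (Filter.Eventually.of_forall fun x hx => ?_)
  rw [← mul_sub, norm_mul, mul_comm]
  have := hc m x
  rw [show π₁ x = j.2 from congrArg Prod.snd hx] at this
  exact mul_le_mul_of_nonneg_right this (norm_nonneg _)

/-! ### Finite rank approximation of compact operators -/

section Averaging

theorem coeFn_finsetSum {ι : Type*} (t : Finset ι) (f : ι → L101) :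
    ⇑(∑ i ∈ t, f i) =ᵐ[volume] fun x => ∑ i ∈ t, f i x := by
  classical
  induction t using Finset.induction_on with
  | empty => simpa using! Lp.coeFn_zero ℝ 1 (volume : Measure I)
  | insert i t hi ih =>
    rw [Finset.sum_insert hi]
    filter_upwards [Lp.coeFn_add (f i) (∑ i ∈ t, f i), ih] with x h1 h2
    rw [h1, Pi.add_apply, h2, Finset.sum_insert hi]

/-- Integration over `A` as a functional on `L₁[0,1]`. -/
noncomputable def setIntegralL1 (A : Set I) : StrongDual ℝ L101 :=
  L1.integralCLM ∘L LpToLpRestrictCLM I ℝ ℝ volume 1 A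

theorem setIntegralL1_apply (A : Set I) (g : L101) : setIntegralL1 A g = ∫ x in A, g x := by
  have h := integral_congr_ae (LpToLpRestrictCLM_coeFn ℝ A g)
  rw [← h]
  exact (L1.integral_eq (LpToLpRestrictCLM I ℝ ℝ volume 1 A g)).symm.trans
    (L1.integral_eq_integral _)

theorem norm_normalizedIndicator_le {A : Set I} (hA : MeasurableSet A) :
    ‖normalizedIndicator hA‖ ≤ 1 := by
  by_cases h0 : volume A = 0
  · have h1 : volume.real A = 0 := by simp [Measure.real, h0]
    rw [normalizedIndicator, norm_indicatorConstLp one_ne_zero ENNReal.one_ne_top]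
    simp [h1]
  · exact (norm_normalizedIndicator hA h0).le

variable {κ : Type*} [Fintype κ] {π : I → κ}

/-- The conditional expectation on a finite partition is a contraction of `L₁[0,1]`. -/
theorem norm_sum_setIntegral_smul_le (hπ : ∀ j, MeasurableSet (π ⁻¹' {j})) (g : L101) :
    ‖∑ j, (∫ x in π ⁻¹' {j}, g x) • normalizedIndicator (hπ j)‖ ≤ ‖g‖ := by
  refine (norm_sum_le _ _).trans ((Finset.sum_le_sum fun j _ => ?_).trans
    (sum_abs_setIntegral_le_norm hπ g))
  rw [norm_smul, Real.norm_eq_abs]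
  exact mul_le_of_le_one_right (abs_nonneg _) (norm_normalizedIndicator_le _)

/-- The conditional expectation on a finite partition fixes the step functions. -/
theorem sum_setIntegral_smul_eq_self (hπ : ∀ j, MeasurableSet (π ⁻¹' {j})) {b : L101}
    (hb : b ∈ stepSubmodule π) :
    ∑ j, (∫ x in π ⁻¹' {j}, b x) • normalizedIndicator (hπ j) = b := by
  classical
  obtain ⟨e, he⟩ := hb
  have hint : ∀ j, ∫ x in π ⁻¹' {j}, b x = volume.real (π ⁻¹' {j}) * e j := fun j => by
    rw [integral_congr_ae (ae_restrict_of_ae he),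
      setIntegral_congr_fun (g := fun _ => e j) (hπ j) fun x hx => by rw [show π x = j from hx],
      setIntegral_const, smul_eq_mul]
  -- almost no point lies in a fibre of measure zero
  have hnull : ∀ᵐ x ∂(volume : Measure I), ∀ j, x ∈ π ⁻¹' {j} → volume.real (π ⁻¹' {j}) ≠ 0 := by
    refine ae_all_iff.2 fun j => ?_
    by_cases h0 : volume (π ⁻¹' {j}) = 0
    · filter_upwards [measure_eq_zero_iff_ae_notMem.1 h0] with x hx hx'
      exact absurd hx' hx
    · exact Filter.Eventually.of_forall fun x _ => by
        simpa [Measure.real, ENNReal.toReal_eq_zero_iff] using h0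
  have hsm : ∀ᵐ x ∂(volume : Measure I), ∀ j,
      ((∫ x in π ⁻¹' {j}, b x) • normalizedIndicator (hπ j)) x =
        (∫ x in π ⁻¹' {j}, b x) *
          (π ⁻¹' {j}).indicator (fun _ => (volume.real (π ⁻¹' {j}))⁻¹) x := by
    refine ae_all_iff.2 fun j => ?_
    filter_upwards [Lp.coeFn_smul (∫ x in π ⁻¹' {j}, b x) (normalizedIndicator (hπ j)),
      indicatorConstLp_coeFn (p := 1) (hs := hπ j) (hμs := measure_ne_top volume (π ⁻¹' {j}))
        (c := (volume.real (π ⁻¹' {j}))⁻¹)] with x h1 h2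
    rw [h1, Pi.smul_apply, smul_eq_mul]
    congr 1
  refine Lp.ext ?_
  filter_upwards [coeFn_finsetSum Finset.univ
    fun j => (∫ x in π ⁻¹' {j}, b x) • normalizedIndicator (hπ j), he, hnull, hsm]
    with x h1 h2 h3 h4
  rw [h1, h2, Finset.sum_eq_single (π x)]
  · rw [h4, hint, Set.indicator_of_mem (show x ∈ π ⁻¹' {π x} from rfl)]
    field_simp [h3 (π x) rfl]
  · intro j _ hj
    rw [h4, Set.indicator_of_notMem (show x ∉ π ⁻¹' {j} from fun h => hj h.symm), mul_zero]
  · simp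

theorem norm_sum_setIntegral_smul_sub_le (hπ : ∀ j, MeasurableSet (π ⁻¹' {j})) {g b : L101}
    (hb : b ∈ stepSubmodule π) :
    ‖∑ j, (∫ x in π ⁻¹' {j}, g x) • normalizedIndicator (hπ j) - g‖ ≤ 2 * ‖g - b‖ := by
  have h := norm_sum_setIntegral_smul_le hπ (g - b)
  have h1 : ∑ j, (∫ x in π ⁻¹' {j}, (g - b) x) • normalizedIndicator (hπ j) =
      ∑ j, (∫ x in π ⁻¹' {j}, g x) • normalizedIndicator (hπ j) - b := by
    conv_rhs => rw [← sum_setIntegral_smul_eq_self hπ hb]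
    simp only [← setIntegralL1_apply, map_sub, sub_smul, Finset.sum_sub_distrib]
  rw [h1] at h
  calc ‖∑ j, (∫ x in π ⁻¹' {j}, g x) • normalizedIndicator (hπ j) - g‖
      = ‖(∑ j, (∫ x in π ⁻¹' {j}, g x) • normalizedIndicator (hπ j) - b) - (g - b)‖ := by
        congr 1; abel
    _ ≤ ‖∑ j, (∫ x in π ⁻¹' {j}, g x) • normalizedIndicator (hπ j) - b‖ + ‖g - b‖ := norm_sub_le _ _
    _ ≤ 2 * ‖g - b‖ := by linarith

end Averaging

/-- Finitely many integrable functions are close to step functions on a common partition, whose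
pieces are the joint level sets of approximating simple functions. -/
theorem exists_partition_norm_sub_le {k : Type} [Fintype k] (g : k → L101) {η : ℝ} (hη : 0 < η) :
    ∃ (κ : Type) (_ : Fintype κ) (π : I → κ), (∀ j, MeasurableSet (π ⁻¹' {j})) ∧
      ∀ m, ∃ b ∈ stepSubmodule π, ‖g m - b‖ ≤ η := by
  classical
  choose s hs using fun m => (Lp.simpleFunc.denseRange (E := ℝ) (μ := (volume : Measure I))
    ENNReal.one_ne_top).exists_dist_lt (g m) hη
  let q : I → k → ℝ := fun x m => Lp.simpleFunc.toSimpleFunc (s m) x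
  have hq : Measurable q := measurable_pi_lambda _ fun m => SimpleFunc.measurable _
  have hfin : (Set.range q).Finite := by
    refine (Set.Finite.pi' fun m => (Lp.simpleFunc.toSimpleFunc (s m)).finite_range).subset ?_
    rintro _ ⟨x, rfl⟩ m
    exact ⟨x, rfl⟩
  refine ⟨Set.range q, hfin.fintype, Set.rangeFactorization q, fun j => ?_, fun m =>
    ⟨s m, ⟨fun j => j.1 m, ?_⟩, ?_⟩⟩
  · have : Set.rangeFactorization q ⁻¹' {j} = q ⁻¹' {j.1} := by
      ext x
      simp [Set.rangeFactorization, Subtype.ext_iff]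
    rw [this]
    exact hq (measurableSet_singleton _)
  · filter_upwards [Lp.simpleFunc.toSimpleFunc_eq_toFun (s m)] with x hx
    exact hx.symm
  · rw [← dist_eq_norm]
    exact (hs m).le

/-- Bernstein operators are contractions. -/
theorem norm_sum_bernstein_le (n : ℕ) (f : C01) :
    ‖∑ i : Fin (n + 1), f (bernstein.z i) • bernstein n i‖ ≤ ‖f‖ := by
  refine (ContinuousMap.norm_le _ (norm_nonneg _)).2 fun x => ?_
  rw [ContinuousMap.sum_apply]
  refine (norm_sum_le _ _).trans ?_
  calc ∑ i : Fin (n + 1), ‖(f (bernstein.z i) • bernstein n i) x‖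
      ≤ ∑ i : Fin (n + 1), ‖f‖ * bernstein n i x := by
        refine Finset.sum_le_sum fun i _ => ?_
        rw [ContinuousMap.smul_apply, norm_smul, Real.norm_of_nonneg (bernstein_nonneg (x := x))]
        exact mul_le_mul_of_nonneg_right (f.norm_coe_le_norm _) bernstein_nonneg
    _ = ‖f‖ := by rw [← Finset.mul_sum, bernstein.probability, mul_one]

theorem exists_norm_sum_bernstein_sub_le (t : Finset C01) {η : ℝ} (hη : 0 < η) :
    ∃ n : ℕ, ∀ f ∈ t, ‖∑ i : Fin (n + 1), f (bernstein.z i) • bernstein n i - f‖ ≤ η := by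
  have h : ∀ f ∈ t, ∀ᶠ n in Filter.atTop, ‖bernsteinApproximation n f - f‖ < η := fun f _ => by
    have := (Metric.tendsto_nhds.1 (bernsteinApproximation_uniform f)) η hη
    simpa only [dist_eq_norm] using this
  obtain ⟨n, hn⟩ := ((Finset.eventually_all t).2 h).exists
  refine ⟨n, fun f hf => ?_⟩
  have : ∑ i : Fin (n + 1), f (bernstein.z i) • bernstein n i = bernsteinApproximation n f := by
    ext x
    simp [bernsteinApproximation.apply, ContinuousMap.sum_apply, mul_comm]
  rw [this]
  exact (hn f hf).le

/-- The space `C[0,1] × L₁[0,1]` has the metric approximation property, with finite rank operators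
which take their `L₁`-components in step functions. -/
theorem exists_finiteRank_approx_id (t : Finset (C01 × L101)) {η : ℝ} (hη : 0 < η) :
    ∃ (k κ : Type) (_ : Fintype k) (_ : Fintype κ) (π : I → κ) (φ : k → StrongDual ℝ (C01 × L101))
      (u : k → C01 × L101), (∀ j, MeasurableSet (π ⁻¹' {j})) ∧
      (∀ m, (u m).2 ∈ stepSubmodule π) ∧ (∀ w, ‖∑ m, φ m w • u m‖ ≤ ‖w‖) ∧
      ∀ w ∈ t, ‖∑ m, φ m w • u m - w‖ ≤ η := by
  classical
  obtain ⟨n, hn⟩ := exists_norm_sum_bernstein_sub_le (t.image Prod.fst) hη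
  obtain ⟨κ, _, π, hπ, hb⟩ := exists_partition_norm_sub_le (fun w : t => w.1.2) (half_pos hη)
  let φ : Fin (n + 1) ⊕ κ → StrongDual ℝ (C01 × L101) := Sum.elim
    (fun i => ContinuousMap.evalCLM ℝ (bernstein.z i) ∘L ContinuousLinearMap.fst ℝ C01 L101)
    (fun j => setIntegralL1 (π ⁻¹' {j}) ∘L ContinuousLinearMap.snd ℝ C01 L101)
  let u : Fin (n + 1) ⊕ κ → C01 × L101 := Sum.elim
    (fun i => (bernstein n i, 0)) (fun j => (0, normalizedIndicator (hπ j)))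
  have hsum : ∀ w : C01 × L101, ∑ m, φ m w • u m =
      (∑ i : Fin (n + 1), w.1 (bernstein.z i) • bernstein n i,
        ∑ j, (∫ x in π ⁻¹' {j}, w.2 x) • normalizedIndicator (hπ j)) := fun w => by
    rw [Fintype.sum_sum_type]
    simp only [φ, u, Sum.elim_inl, Sum.elim_inr, Prod.smul_mk, smul_zero,
      ContinuousLinearMap.comp_apply, ContinuousLinearMap.coe_fst', ContinuousLinearMap.coe_snd',
      setIntegralL1_apply]
    ext1
    · simp [Prod.fst_sum]
    · simp [Prod.snd_sum]
  refine ⟨Fin (n + 1) ⊕ κ, κ, inferInstance, inferInstance, π, φ, u, hπ, ?_, fun w => ?_,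
    fun w hw => ?_⟩
  · rintro (i | j)
    · exact zero_mem _
    · exact normalizedIndicator_mem_stepSubmodule (hπ j)
  · rw [hsum, Prod.norm_def, Prod.norm_def]
    exact max_le_max (norm_sum_bernstein_le n w.1) (norm_sum_setIntegral_smul_le hπ w.2)
  · obtain ⟨b, hbm, hbn⟩ := hb ⟨w, hw⟩
    rw [hsum, Prod.norm_def]
    refine max_le (hn w.1 (Finset.mem_image_of_mem _ hw)) ?_
    refine (norm_sum_setIntegral_smul_sub_le hπ hbm).trans ?_
    linarith

/-- A contraction that is close to the identity on a finite net of the image of the unit ball is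
composed with `T`. -/
theorem exists_finiteRank_norm_sub_le {T : C01 × L101 →L[ℝ] C01 × L101}
    (hT : IsCompactOperator T) {ε : ℝ} (hε : 0 < ε) :
    ∃ (k κ : Type) (_ : Fintype k) (_ : Fintype κ) (π : I → κ) (Ψ : k → StrongDual ℝ (C01 × L101))
      (u : k → C01 × L101), (∀ j, MeasurableSet (π ⁻¹' {j})) ∧
      (∀ m, (u m).2 ∈ stepSubmodule π) ∧ ∀ z, ‖T z - ∑ m, Ψ m z • u m‖ ≤ ε * ‖z‖ := by
  have hcpt := hT.isCompact_closure_image_closedBall (f := T.toLinearMap) 1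
  obtain ⟨t, -, htf, hcov⟩ := hcpt.finite_cover_balls (e := ε / 3) (by positivity)
  obtain ⟨k, κ, _, _, π, φ, u, hπ, hu, hle, hap⟩ :=
    exists_finiteRank_approx_id htf.toFinset (show 0 < ε / 3 by positivity)
  let P : C01 × L101 →L[ℝ] C01 × L101 := ∑ m, (φ m).smulRight (u m)
  have hP : ∀ w, P w = ∑ m, φ m w • u m := fun w => by
    simp [P]
  refine ⟨k, κ, inferInstance, inferInstance, π, fun m => φ m ∘L T, u, hπ, hu, fun z => ?_⟩
  have hnorm : ‖T - P ∘L T‖ ≤ ε := by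
    refine ContinuousLinearMap.opNorm_le_of_unit_norm hε.le fun z hz => ?_
    have hTz : T z ∈ ⋃ x ∈ t, Metric.ball x (ε / 3) :=
      hcov (subset_closure ⟨z, by simp [hz], rfl⟩)
    simp only [Set.mem_iUnion] at hTz
    obtain ⟨v, hv, hvz⟩ := hTz
    rw [Metric.mem_ball, dist_eq_norm] at hvz
    have h1 : ‖P (T z - v)‖ ≤ ‖T z - v‖ := by rw [hP]; exact hle _
    have h2 : ‖P v - v‖ ≤ ε / 3 := by rw [hP]; exact hap v (htf.mem_toFinset.2 hv)
    calc ‖(T - P ∘L T) z‖ = ‖(T z - v) - P (T z - v) - (P v - v)‖ := by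
          rw [map_sub]
          simp only [sub_apply, ContinuousLinearMap.comp_apply]
          congr 1
          abel
      _ ≤ ‖T z - v‖ + ‖P (T z - v)‖ + ‖P v - v‖ :=
        (norm_sub_le _ _).trans (add_le_add_left (norm_sub_le _ _) _)
      _ ≤ ε := by linarith
  have := (T - P ∘L T).le_of_opNorm_le hnorm z
  simpa [hP] using this

/-! ### Density of simple operators -/

/-- Integration over `A` with respect to a finite measure as a functional on `C[0,1]`. -/
noncomputable def setIntegralC (ν : Measure I) [IsFiniteMeasure ν] (A : Set I) :
    StrongDual ℝ C01 :=
  L1.integralCLM ∘L ContinuousMap.toLp 1 (ν.restrict A) ℝ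

theorem setIntegralC_apply (ν : Measure I) [IsFiniteMeasure ν] (A : Set I) (f : C01) :
    setIntegralC ν A f = ∫ x in A, f x ∂ν := by
  rw [← integral_congr_ae (ContinuousMap.coeFn_toLp (p := 1) (𝕜 := ℝ) (ν.restrict A) f)]
  exact (L1.integral_eq (ContinuousMap.toLp 1 (ν.restrict A) ℝ f)).symm.trans
    (L1.integral_eq_integral _)

theorem isCompactOperator_smulRight {E : Type*} [NormedAddCommGroup E] [NormedSpace ℝ E]
    (φ : StrongDual ℝ E) (u : E) : IsCompactOperator (φ.smulRight u) :=
  (isCompactOperator_of_locallyCompactSpace_dom φ).clm_comp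
    (ContinuousLinearMap.toSpanSingleton ℝ u)

namespace SimpleOperatorData

variable {ι κ : Type*} [Fintype ι] [Fintype κ] (D : SimpleOperatorData ι κ)

/-- The operator given by the data. -/
noncomputable def toCLM : C01 × L101 →L[ℝ] C01 × L101 :=
  ∑ i, (setIntegralC D.ν (D.K i) ∘L ContinuousLinearMap.fst ℝ C01 L101).smulRight (D.u i) +
    ∑ j, (setIntegralL1 (D.π ⁻¹' {j}) ∘L ContinuousLinearMap.snd ℝ C01 L101).smulRight (D.w j)

theorem toCLM_apply (z : C01 × L101) : D.toCLM z = D.toFun z := by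
  simp [toCLM, toFun, setIntegralC_apply, setIntegralL1_apply]

theorem isCompactOperator_toCLM : IsCompactOperator D.toCLM := by
  have h := (compactOperator (RingHom.id ℝ) (C01 × L101) (C01 × L101)).add_mem
    (Submodule.sum_mem _ fun i (_ : i ∈ Finset.univ) => isCompactOperator_smulRight
      (setIntegralC D.ν (D.K i) ∘L ContinuousLinearMap.fst ℝ C01 L101) (D.u i))
    (Submodule.sum_mem _ fun j (_ : j ∈ Finset.univ) => isCompactOperator_smulRight
      (setIntegralL1 (D.π ⁻¹' {j}) ∘L ContinuousLinearMap.snd ℝ C01 L101) (D.w j))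
  exact h

end SimpleOperatorData

/-- The functionals in a finite rank approximation of `T` are replaced by combinations of integrals.
The partition of the domain refines the partition of the range, so that the values remain step
functions. -/
theorem exists_simpleOperator_norm_sub_le {T : C01 × L101 →L[ℝ] C01 × L101}
    (hT : IsCompactOperator T) {ε : ℝ} (hε : 0 < ε) :
    ∃ (ι κ : Type) (_ : Fintype ι) (_ : Fintype κ) (D : SimpleOperatorData ι κ),
      ‖T - D.toCLM‖ ≤ ε := by
  obtain ⟨k, κ₀, _, _, π₀, Ψ, u, hπ₀, hu, hΨ⟩ := exists_finiteRank_norm_sub_le hT (half_pos hε)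
  set N : ℝ := ∑ m, ‖u m‖ with hN
  have hN0 : 0 ≤ N := Finset.sum_nonneg fun m _ => norm_nonneg _
  have hη : 0 < ε / 4 / (N + 1) := by positivity
  obtain ⟨ι, _, ν, hν, K, a, hKc, hKd, ha⟩ := exists_closed_sets_abs_sub_le
    (fun m => Ψ m ∘L ContinuousLinearMap.inl ℝ C01 L101) hη
  obtain ⟨κ, _, π, c, hπ, hππ₀, hc⟩ := exists_refinement_abs_sub_le
    (fun m => Ψ m ∘L ContinuousLinearMap.inr ℝ C01 L101) hπ₀ hη
  have hstep : ∀ m, (u m).2 ∈ stepSubmodule π := fun m => by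
    obtain ⟨e, he⟩ := hu m
    exact ⟨fun j => e j.1, by simpa only [hππ₀] using he⟩
  let D : SimpleOperatorData ι (κ₀ × κ) :=
    { ν := ν, finite := hν, K := K, isClosed := hKc, disjoint := hKd, π := π, measurable := hπ
      u := fun i => ∑ m, a m i • u m
      w := fun j => ∑ m, c m j • u m
      u_mem := fun i => by
        rw [Prod.snd_sum]
        exact sum_mem fun m _ => Submodule.smul_mem _ _ (hstep m)
      w_mem := fun j => by
        rw [Prod.snd_sum]
        exact sum_mem fun m _ => Submodule.smul_mem _ _ (hstep m) }
  refine ⟨ι, κ₀ × κ, inferInstance, inferInstance, D,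
    ContinuousLinearMap.opNorm_le_bound _ hε.le fun z => ?_⟩
  let s : k → ℝ := fun m => ∑ i, (∫ x in K i, z.1 x ∂ν) * a m i +
    ∑ j, (∫ x in π ⁻¹' {j}, z.2 x) * c m j
  have hD : D.toCLM z = ∑ m, s m • u m := by
    rw [D.toCLM_apply, SimpleOperatorData.toFun]
    simp only [D, s, Finset.smul_sum, smul_smul, add_smul, Finset.sum_add_distrib, Finset.sum_smul]
    rw [Finset.sum_comm]
    congr 1
    rw [Finset.sum_comm]
  have hs : ∀ m, |Ψ m z - s m| ≤ 2 * (ε / 4 / (N + 1)) * ‖z‖ := fun m => by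
    have h1 := ha m z.1
    have h2 := hc m z.2
    have h3 : Ψ m z = Ψ m (z.1, 0) + Ψ m (0, z.2) := by rw [← map_add]; simp
    have h4 : Ψ m z - s m = (Ψ m (z.1, 0) - ∑ i, (∫ x in K i, z.1 x ∂ν) * a m i) +
        (Ψ m (0, z.2) - ∑ j, (∫ x in π ⁻¹' {j}, z.2 x) * c m j) := by
      rw [h3]
      ring
    rw [h4]
    refine (abs_add_le _ _).trans ((add_le_add h1 h2).trans ?_)
    have h5 := mul_le_mul_of_nonneg_left (norm_fst_le z) hη.le
    have h6 := mul_le_mul_of_nonneg_left (norm_snd_le z) hη.le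
    linarith
  have h1 : ‖∑ m, (Ψ m z - s m) • u m‖ ≤ ε / 2 * ‖z‖ := by
    calc ‖∑ m, (Ψ m z - s m) • u m‖ ≤ ∑ m, 2 * (ε / 4 / (N + 1)) * ‖z‖ * ‖u m‖ := by
          refine (norm_sum_le _ _).trans (Finset.sum_le_sum fun m _ => ?_)
          rw [norm_smul]
          exact mul_le_mul_of_nonneg_right (hs m) (norm_nonneg _)
      _ = 2 * (ε / 4 / (N + 1) * N) * ‖z‖ := by rw [← Finset.mul_sum]; ring
      _ ≤ ε / 2 * ‖z‖ := by
          refine mul_le_mul_of_nonneg_right ?_ (norm_nonneg _)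
          have : ε / 4 / (N + 1) * N ≤ ε / 4 := by
            rw [div_mul_eq_mul_div]
            exact div_le_of_le_mul₀ (by positivity) (by positivity) (by nlinarith)
          linarith
  have h2 : (T - D.toCLM) z = (T z - ∑ m, Ψ m z • u m) + ∑ m, (Ψ m z - s m) • u m := by
    simp only [sub_apply, hD, sub_smul, Finset.sum_sub_distrib]
    abel
  rw [h2]
  refine (norm_add_le _ _).trans ?_
  linarith [hΨ z]

/-- The approximation does not depend on which of the equivalent product norms is used. -/
theorem exists_simpleOperator_conj {Z : Type*} [NormedAddCommGroup Z] [NormedSpace ℝ Z]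
    (e : Z ≃L[ℝ] C01 × L101) {T : Z →L[ℝ] Z} (hT : IsCompactOperator T) {ε : ℝ} (hε : 0 < ε) :
    ∃ (ι κ : Type) (_ : Fintype ι) (_ : Fintype κ) (D : SimpleOperatorData ι κ) (S : Z →L[ℝ] Z),
      (∀ w, S (e.symm w) = e.symm (D.toFun w)) ∧ IsCompactOperator S ∧ ‖T - S‖ < ε := by
  let E : Z →L[ℝ] C01 × L101 := e
  let E' : C01 × L101 →L[ℝ] Z := e.symm
  have hcpt : IsCompactOperator (E ∘L T ∘L E') := (hT.comp_clm E').clm_comp E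
  set M := ‖E'‖ * ‖E‖ with hM
  have hM0 : 0 ≤ M := by positivity
  obtain ⟨ι, κ, _, _, D, hD⟩ := exists_simpleOperator_norm_sub_le hcpt
    (show 0 < ε / (M + 1) by positivity)
  refine ⟨ι, κ, inferInstance, inferInstance, D, E' ∘L D.toCLM ∘L E, fun w => ?_,
    (D.isCompactOperator_toCLM.comp_clm E).clm_comp E', ?_⟩
  · simp [E, E', D.toCLM_apply]
  have h : T - E' ∘L D.toCLM ∘L E = E' ∘L (E ∘L T ∘L E' - D.toCLM) ∘L E := by
    ext z
    simp [E, E']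
  rw [h]
  calc ‖E' ∘L (E ∘L T ∘L E' - D.toCLM) ∘L E‖
      ≤ ‖E'‖ * (‖E ∘L T ∘L E' - D.toCLM‖ * ‖E‖) :=
        (ContinuousLinearMap.opNorm_comp_le _ _).trans
          (mul_le_mul_of_nonneg_left (ContinuousLinearMap.opNorm_comp_le _ _) (norm_nonneg _))
    _ ≤ ‖E'‖ * (ε / (M + 1) * ‖E‖) := by gcongr
    _ = ε / (M + 1) * M := by rw [hM]; ring
    _ < ε := by
      rw [div_mul_eq_mul_div, div_lt_iff₀ (by positivity)]
      nlinarith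

end NumRadius

theorem mainTheorem4 :
    (∀ T ∈ NumRadius.compactOperators ℝ NumRadius.SumOne, ∀ ε : ℝ, 0 < ε →
      ∃ S ∈ NumRadius.NRA ℝ NumRadius.SumOne ∩ NumRadius.compactOperators ℝ NumRadius.SumOne,
        ‖T - S‖ < ε) ∧
    (∀ T ∈ NumRadius.compactOperators ℝ NumRadius.SumInfty, ∀ ε : ℝ, 0 < ε →
      ∃ S ∈ NumRadius.NRA ℝ NumRadius.SumInfty ∩ NumRadius.compactOperators ℝ NumRadius.SumInfty,
        ‖T - S‖ < ε) := by
  constructor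
  · intro T hT ε hε
    obtain ⟨ι, κ, _, _, D, S, hS, hSc, hTS⟩ := NumRadius.exists_simpleOperator_conj
      (WithLp.prodContinuousLinearEquiv 1 ℝ NumRadius.C01 NumRadius.L101) hT hε
    exact ⟨S, ⟨D.mem_NRA_sumOne hS, hSc⟩, hTS⟩
  · intro T hT ε hε
    obtain ⟨ι, κ, _, _, D, S, hS, hSc, hTS⟩ := NumRadius.exists_simpleOperator_conj
      (WithLp.prodContinuousLinearEquiv ∞ ℝ NumRadius.C01 NumRadius.L101) hT hε
    exact ⟨S, ⟨D.mem_NRA_sumInfty hS, hSc⟩, hTS⟩
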